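/- Let $F$ be a number field with algebraic closure $\overline F$ and ring of integers $\mathcal O_F$, let $E/F$ be an elliptic curve with conductor $N_{E/F}\subseteq\mathcal O_F$, and let $N>2$ be an integer. For $\alpha\in F^\times$ let $E^\alpha$ be the quadratic twist of $E$ by $\alpha$ (if $E: y^2=x^3+ax^2+bx+c$, then $E^\alpha:\alpha y^2=x^3+ax^2+bx+c$). Write $\rho_{E^\alpha,N}\colon \operatorname{Gal}(\overline F/F)\to \operatorname{Aut}_{\mathbb Z/N}(E^\alpha[N])\cong \operatorname{GL}(2,\mathbb Z/N\mathbb Z)$ for the Galois representation on the $N$-torsion points of $E^\alpha$ over $\overline F$. Let $T$ be the set of $\alpha\in F^\times$ such that $-\operatorname{Id}$ does not belong to the image of $\rho_{E^\alpha,N}$. Then: 1. For every $\alpha\in T$, $\sqrt\alpha\in F(E[N])$. 2. For every $\alpha\in T$, every prime ideal of $\mathcal O_F$ that ramifies in $F(\sqrt\alpha)/F$ divides $N$ or $N_{E/F}$. 3. There is a largest abelian extension $M/F$ (inside $\overline F$) of exponent dividing $2$ that is unramified outside the infinite places of $F$ and the primes dividing $N\cdot N_{E/F}$, and $F(\sqrt\alpha)\subseteq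 M$ for every $\alpha\in T$. 4. The image of $T$ in $F^\times/(F^\times)^2$ is finite. 5. Suppose that $F$ is a real quadratic field of class number $1$. Let $N_E$ be the absolute norm of $N_{E/F}$, let $\wp_1,\dots,\wp_n$ be the distinct prime ideals of $\mathcal O_F$ dividing the integer $N\cdot N_E$, let $\wp_i=(\pi_i)$ with $\pi_i\in\mathcal O_F$, and let $u_F$ be a fundamental unit, i.e. $\mathcal O_F^\times=\langle -1,u_F\rangle$. Then every $\alpha\in T$ is, up to multiplication by a square in $F^\times$, an element of $$\{\pm u_F^{k_0}\pi_1^{k_1}\cdots\pi_n^{k_n} : k_0,\dots,k_n\in\{0,1\}\}.$$ -/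

import Mathlib

open scoped NumberField

noncomputable section

namespace EllipticTwist

open IsDedekindDomain IntermediateField

section Torsion

variable {F : Type*} [Field F] (E : WeierstrassCurve F) (K : Type*) [Field K] [Algebra F K]

/-- The group `E(K)` of `K`-rational points. -/
abbrev Points : Type _ := (E.baseChange K).toAffine.Point

open Classical in
instance instAddCommGroupPoints : AddCommGroup (Points E K) := inferInstance

/-- The subgroup `E(K)[N]` of points killed by `N`. -/
abbrev torsion (N : ℕ) : AddSubgroup (Points E K) := AddSubgroup.torsionBy (Points E K) (N : ℤ)

instance instModuleTorsion (N : ℕ) : Module (ZMod N) (torsion E K N) :=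
  AddSubgroup.torsionBy.zmodModule

open Classical in
/-- The coordinatewise action of an automorphism `σ` of `K / F` on `E(K)`. -/
def galPoint (σ : K ≃ₐ[F] K) : Points E K →+ Points E K :=
  WeierstrassCurve.Affine.Point.map (W' := E) (σ : K →ₐ[F] K)

theorem galPoint_one (P : Points E K) : galPoint E K 1 P = P := by
  cases P <;> rfl

theorem galPoint_mul (σ τ : K ≃ₐ[F] K) (P : Points E K) :
    galPoint E K (σ * τ) P = galPoint E K σ (galPoint E K τ P) := by
  cases P <;> rfl

theorem galPoint_mem (N : ℕ) (σ : K ≃ₐ[F] K) {P : Points E K} (hP : P ∈ torsion E K N) :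
    galPoint E K σ P ∈ torsion E K N := by
  rw [AddSubgroup.torsionBy.nsmul_iff] at hP ⊢
  rw [← map_nsmul, hP, map_zero]

/-- The action of an automorphism `σ` of `K / F` on `E(K)[N]`. -/
def galTorsion (N : ℕ) (σ : K ≃ₐ[F] K) : torsion E K N →ₗ[ZMod N] torsion E K N :=
  AddMonoidHom.toZModLinearMap N
    (((galPoint E K σ).comp (torsion E K N).subtype).codRestrict (torsion E K N)
      fun P => galPoint_mem E K N σ P.2)

theorem galTorsion_one (N : ℕ) : galTorsion E K N 1 = 1 :=
  LinearMap.ext fun P => Subtype.ext (galPoint_one E K P)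

theorem galTorsion_mul (N : ℕ) (σ τ : K ≃ₐ[F] K) :
    galTorsion E K N (σ * τ) = galTorsion E K N σ * galTorsion E K N τ :=
  LinearMap.ext fun P => Subtype.ext (galPoint_mul E K σ τ P)

/-- The representation of `Aut(K / F)` on the `ℤ/N`-module `E(K)[N]`. -/
def torsionRep (N : ℕ) : (K ≃ₐ[F] K) →* LinearMap.GeneralLinearGroup (ZMod N) (torsion E K N) :=
  MonoidHom.toHomUnits
    { toFun := galTorsion E K N
      map_one' := galTorsion_one E K N
      map_mul' := galTorsion_mul E K N }

/-- The mod-`N` Galois representation `ρ_{E,N} : G_F → GL(E[N])`, where `E[N]` is the group of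
`N`-torsion points over an algebraic closure. For an elliptic curve over a field of characteristic
zero and `N ≥ 1`, a `ℤ/N`-basis of `E[N]` identifies the target with `GL(2, ℤ/N)`. -/
def galRep (N : ℕ) :
    (AlgebraicClosure F ≃ₐ[F] AlgebraicClosure F) →*
      LinearMap.GeneralLinearGroup (ZMod N) (torsion E (AlgebraicClosure F) N) :=
  torsionRep E (AlgebraicClosure F) N

/-- The `N`-division field `F(E[N])`, generated over `F` by the coordinates of all affine
`N`-torsion points over the algebraic closure. -/
def divisionField (N : ℕ) : IntermediateField F (AlgebraicClosure F) :=
  adjoin F {z | ∃ (x y : AlgebraicClosure F)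
    (h : (E.baseChange (AlgebraicClosure F)).toAffine.Nonsingular x y),
    (.some x y h : Points E (AlgebraicClosure F)) ∈ torsion E (AlgebraicClosure F) N ∧
      (z = x ∨ z = y)}

/-- The quadratic twist `E^α`, in characteristic different from `2`: completing the square turns
`E` into `y² = x³ + (b₂/4) x² + (b₄/2) x + b₆/4`, and `E^α` is the Weierstrass form of
`α y² = x³ + (b₂/4) x² + (b₄/2) x + b₆/4` in the coordinates `(α x, α² y)`. -/
def quadraticTwist (α : F) : WeierstrassCurve F where
  a₁ := 0
  a₂ := α * (E.b₂ / 4)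
  a₃ := 0
  a₄ := α ^ 2 * (E.b₄ / 2)
  a₆ := α ^ 3 * (E.b₆ / 4)

end Torsion

section Ramification

variable {F : Type*} [Field F] [NumberField F]

/-- The prime `v` of `F` ramifies in the extension `L / F` of number fields: some prime of `L`
above `v` has ramification index greater than `1`. -/
def RamifiesIn (v : HeightOneSpectrum (𝓞 F)) (L : Type*) [Field L] [Algebra F L] : Prop :=
  ∃ P : Ideal (𝓞 L), P.IsPrime ∧ P.LiesOver v.asIdeal ∧ 1 < P.ramificationIdx (𝓞 F)

/-- The algebraic extension `L / F` is unramified at every finite prime of `F` not dividing `𝔫`,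
that is, each of its finite subextensions is. Nothing is required at the infinite places. -/
def IsUnramifiedOutside (𝔫 : Ideal (𝓞 F)) (L : IntermediateField F (AlgebraicClosure F)) : Prop :=
  ∀ K : IntermediateField F (AlgebraicClosure F), K ≤ L → FiniteDimensional F K →
    ∀ v : HeightOneSpectrum (𝓞 F), RamifiesIn v K → v.asIdeal ∣ 𝔫

/-- `L / F` is an abelian extension of exponent (dividing) `2`. -/
structure IsAbelianOfExponentTwo (L : IntermediateField F (AlgebraicClosure F)) : Prop where
  isGalois : IsGalois F L
  comm : ∀ σ τ : L ≃ₐ[F] L, σ * τ = τ * σ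
  sq_eq_one : ∀ σ : L ≃ₐ[F] L, σ ^ 2 = 1

end Ramification

section Conductor

variable {F : Type*} [Field F] [NumberField F] (E : WeierstrassCurve F)

/-- The discrete valuation ring of the elements of `F` that are integral at `v`. -/
abbrev localRing (v : HeightOneSpectrum (𝓞 F)) : ValuationSubring F :=
  (v.valuation F).valuationSubring

instance instDVRLocalRing (v : HeightOneSpectrum (𝓞 F)) :
    IsDiscreteValuationRing (localRing v) :=
  (v.valuation F).valuationSubring_isDiscreteValuationRing

/-- The `i`-th ramification group in lower numbering, at a prime `P` of `L`: the automorphisms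
of `L / F` that act trivially on `𝓞 L` modulo `P ^ (i + 1)`. -/
def ramificationGroup {L : Type*} [Field L] [Algebra F L] (P : Ideal (𝓞 L)) (i : ℕ) :
    Subgroup (L ≃ₐ[F] L) :=
  (P ^ (i + 1)).toAddSubgroup.inertia (L ≃ₐ[F] L)

/-- The subspace of `E(K)[N]` fixed by a group `G` of automorphisms of `K / F`. -/
def fixedTorsion (K : Type*) [Field K] [Algebra F K] (N : ℕ) (G : Subgroup (K ≃ₐ[F] K)) :
    Submodule (ZMod N) (torsion E K N) :=
  ⨅ σ ∈ G, LinearMap.eqLocus (galTorsion E K N σ) LinearMap.id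

open Classical in
/-- A rational prime different from the residue characteristic of `v`. -/
def auxPrime (v : HeightOneSpectrum (𝓞 F)) : ℕ := if (2 : 𝓞 F) ∈ v.asIdeal then 3 else 2

theorem exists_prime_above (v : HeightOneSpectrum (𝓞 F))
    (L : IntermediateField F (AlgebraicClosure F)) :
    ∃ P : Ideal (𝓞 L), P.IsPrime ∧ P.LiesOver v.asIdeal := by
  obtain ⟨⟨P, hP, hPv⟩⟩ := v.asIdeal.nonempty_primesOver (S := 𝓞 L)
  exact ⟨P, hP, hPv⟩

/-- A prime of `L` above `v`. -/
def primeAbove (v : HeightOneSpectrum (𝓞 F)) (L : IntermediateField F (AlgebraicClosure F)) :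
    Ideal (𝓞 L) :=
  (exists_prime_above v L).choose

/-- The wild part `δ_v = ∑_{i ≥ 1} (g_i / g_0) dim (E[ℓ] / E[ℓ]^{G_i})` of the conductor exponent,
where `ℓ` is a prime different from the residue characteristic of `v`, `L = F(E[ℓ])`, `G_i` are
the ramification groups of `L / F` at a prime above `v`, and `g_i = #G_i`. Almost all terms vanish,
and the value is an integer (so that the division below is exact) which depends neither on `ℓ` nor
on the prime above `v`. All `ℓ`-torsion points are defined over `L`. -/
def wildExponent (v : HeightOneSpectrum (𝓞 F)) : ℕ :=
  let ℓ := auxPrime v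
  let L := divisionField E ℓ
  let G : ℕ → Subgroup (L ≃ₐ[F] L) := ramificationGroup (primeAbove v L)
  (∑ᶠ i : ℕ, Nat.card (G (i + 1)) *
    Module.finrank (ZMod ℓ) (torsion E L ℓ ⧸ fixedTorsion E L ℓ (G (i + 1)))) / Nat.card (G 0)

open Classical in
/-- The exponent of the conductor of `E` at `v`: `0` if `E` has good reduction at `v`, `1` if it has
multiplicative reduction, and `2 + δ_v` if it has additive reduction. -/
def conductorExponent (v : HeightOneSpectrum (𝓞 F)) : ℕ :=
  if (E.minimal (localRing v)).HasGoodReduction (localRing v) then 0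
  else if (E.minimal (localRing v)).HasMultiplicativeReduction (localRing v) then 1
  else 2 + wildExponent E v

/-- The conductor `N_{E/F}` of the elliptic curve `E / F`, an ideal of `𝓞 F`. Only the finitely many
primes of bad reduction contribute to the product. -/
def conductor : Ideal (𝓞 F) :=
  ∏ᶠ v : HeightOneSpectrum (𝓞 F), v.asIdeal ^ conductorExponent E v

end Conductor

/-- The property of `α ∈ F^×` that `-Id` does not belong to the image of `ρ_{E^α,N}`. -/
def TwistImageMissesNegOne {F : Type*} [Field F] (E : WeierstrassCurve F) (N : ℕ) (α : Fˣ) : Prop :=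
  -1 ∉ (galRep (quadraticTwist E (α : F)) N).range

/-- The set `{± u^{k₀} π₁^{k₁} ⋯ πₙ^{kₙ} : k₀, …, kₙ ∈ {0, 1}}`. -/
def twistSet {F : Type*} [Field F] (u : (𝓞 F)ˣ) {n : ℕ} (π : Fin n → 𝓞 F) : Set (𝓞 F) :=
  {a | ∃ (ε : 𝓞 F) (k₀ : Fin 2) (k : Fin n → Fin 2), (ε = 1 ∨ ε = -1) ∧
    a = ε * (u : 𝓞 F) ^ (k₀ : ℕ) * ∏ i, π i ^ (k i : ℕ)}

end EllipticTwist

end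

/-! Over `F(√α)` the curves `E` and `E^α` become isomorphic, and an automorphism `σ` with `σ √α =
-√α` carries this isomorphism to its negative. So if `σ` fixes `E[N]` pointwise and negates `√α`, it
acts as `-1` on `E^α[N]` (`galPoint_quadraticTwist_eq_neg`). For `α ∈ T` there is no such `σ`, and
every assertion follows from that.

(1) is Galois correspondence for `F(E[N])`. For (2), at a prime `v` not dividing `N` or the
conductor, inertia acts trivially on `E[N]`, the easy half of the Néron–Ogg–Shafarevich criterion:
torsion prime to the residue characteristic injects under good reduction
(`torsion_eq_of_val_sub_lt`), since the parameter `t = x/y` is additive to first order near the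
origin (`NearOrigin.add`). If `v` ramified in `F(√α)`, an inertia element would negate `√α`;
`exists_inertia_lift` supplies it in the full Galois group.

(3) `M` is generated by all square roots `β` of elements of `F` with `F(β)` unramified outside `N`
times the conductor. It is greatest because an abelian extension of exponent two is generated by
square roots, obtained by diagonalizing commuting involutions.

(4) By (2), `v(α)` is even outside a finite set of primes. Elements with prescribed parities form
finitely many square classes, by finiteness of the class group and finite generation of the units.

(5) Dividing `α` by suitable `π_i` makes all valuations even; in class number one the quotient is
then a unit times a square. -/

namespace EllipticTwist

open IsDedekindDomain IntermediateField

/-! ### Changes of Weierstrass coordinates are group homomorphisms on points -/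

section VariableChange

open WeierstrassCurve WeierstrassCurve.Affine

variable {K : Type*} [Field K]

theorem variableChange_equation_iff (W : WeierstrassCurve K) (C : VariableChange K) (x y : K) :
    (C • W).toAffine.Equation x y ↔ W.toAffine.Equation (C.u ^ 2 * x + C.r)
      (C.u ^ 3 * y + C.u ^ 2 * C.s * x + C.t) := by
  have hu : (C.u : K) ≠ 0 := C.u.ne_zero
  rw [equation_iff', equation_iff', ← mul_right_inj' (pow_ne_zero 6 hu), mul_zero]
  simp only [variableChange_def, Units.val_inv_eq_inv_val]
  field_simp
  refine Eq.congr ?_ rfl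
  ring

/-- Chain rule: the partial derivatives of the new equation, scaled by `u³` and `u⁴`, are `W_Y`
(`e2`) and `W_X + s W_Y` (`e1`), so the two pairs vanish together. -/
theorem variableChange_nonsingular_iff (W : WeierstrassCurve K) (C : VariableChange K) (x y : K) :
    (C • W).toAffine.Nonsingular x y ↔ W.toAffine.Nonsingular (C.u ^ 2 * x + C.r)
      (C.u ^ 3 * y + C.u ^ 2 * C.s * x + C.t) := by
  have hu : (C.u : K) ≠ 0 := C.u.ne_zero
  have h5 : (C.u : K) ^ 5 ≠ 0 := pow_ne_zero 5 hu
  have h4 : (C.u : K) ^ 4 ≠ 0 := pow_ne_zero 4 hu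
  have h3 : (C.u : K) ^ 3 ≠ 0 := pow_ne_zero 3 hu
  rw [nonsingular_iff', nonsingular_iff', variableChange_equation_iff]
  refine and_congr_right fun _ => ?_
  rw [← not_and_or, ← not_and_or, not_iff_not]
  simp only [variableChange_def, Units.val_inv_eq_inv_val]
  set u : K := (C.u : K)
  have e2 : u ^ 3 * (2 * y + u⁻¹ * (W.a₁ + 2 * C.s) * x + u⁻¹ ^ 3 * (W.a₃ + C.r * W.a₁ + 2 * C.t)) =
      2 * (u ^ 3 * y + u ^ 2 * C.s * x + C.t) + W.a₁ * (u ^ 2 * x + C.r) + W.a₃ := by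
    field_simp
    ring
  have e1 : u ^ 4 * (u⁻¹ * (W.a₁ + 2 * C.s) * y - (3 * x ^ 2 + 2 * (u⁻¹ ^ 2 * (W.a₂ - C.s * W.a₁ +
      3 * C.r - C.s ^ 2)) * x + u⁻¹ ^ 4 * (W.a₄ - C.s * W.a₃ + 2 * C.r * W.a₂ -
      (C.t + C.r * C.s) * W.a₁ + 3 * C.r ^ 2 - 2 * C.s * C.t))) =
      W.a₁ * (u ^ 3 * y + u ^ 2 * C.s * x + C.t) - (3 * (u ^ 2 * x + C.r) ^ 2 +
      2 * W.a₂ * (u ^ 2 * x + C.r) + W.a₄) + C.s * (2 * (u ^ 3 * y + u ^ 2 * C.s * x + C.t) +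
      W.a₁ * (u ^ 2 * x + C.r) + W.a₃) := by
    field_simp
    ring
  constructor
  · rintro ⟨h1, h2⟩
    rw [h1, mul_zero] at e1
    rw [h2, mul_zero] at e2
    exact ⟨by linear_combination -e1 + C.s * e2, e2.symm⟩
  · rintro ⟨h1, h2⟩
    rw [h2] at e2
    rw [h1, h2, mul_zero, add_zero] at e1
    exact ⟨(mul_eq_zero.1 e1).resolve_left h4, (mul_eq_zero.1 e2).resolve_left h3⟩

theorem point_some_eq_some {W : WeierstrassCurve K} {x y x' y' : K} (hx : x = x') (hy : y = y')
    (h : W.toAffine.Nonsingular x y) (h' : W.toAffine.Nonsingular x' y') :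
    (.some x y h : W.toAffine.Point) = .some x' y' h' := by
  subst hx hy
  rfl

variable [DecidableEq K]

/-- The homomorphism `(x, y) ↦ (u² x + r, u³ y + u² s x + t)` from the points of `C • W` to those
of `W`. -/
def variableChangePoint {W W' : WeierstrassCurve K} (C : VariableChange K) (h : W' = C • W) :
    W'.toAffine.Point →+ W.toAffine.Point where
  toFun P := match P with
    | .zero => 0
    | .some x y hP => .some (C.u ^ 2 * x + C.r) (C.u ^ 3 * y + C.u ^ 2 * C.s * x + C.t)
        ((variableChange_nonsingular_iff W C x y).1 (h ▸ hP))
  map_zero' := rfl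
  map_add' := by
    subst h
    have hu : (C.u : K) ≠ 0 := C.u.ne_zero
    have hu2 : (C.u : K) ^ 2 ≠ 0 := pow_ne_zero 2 hu
    have hu3 : (C.u : K) ^ 3 ≠ 0 := pow_ne_zero 3 hu
    have hX {x₁ x₂ : K} : C.u ^ 2 * x₁ + C.r = C.u ^ 2 * x₂ + C.r ↔ x₁ = x₂ := by
      rw [add_left_inj, mul_right_inj' hu2]
    have hN (x y : K) : W.toAffine.negY (C.u ^ 2 * x + C.r) (C.u ^ 3 * y + C.u ^ 2 * C.s * x + C.t) =
        C.u ^ 3 * (C • W).toAffine.negY x y + C.u ^ 2 * C.s * x + C.t := by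
      simp only [negY, variableChange_def, Units.val_inv_eq_inv_val]
      field_simp
      ring
    have hY {x y₁ y₂ : K} : C.u ^ 3 * y₁ + C.u ^ 2 * C.s * x + C.t =
        C.u ^ 3 * y₂ + C.u ^ 2 * C.s * x + C.t ↔ y₁ = y₂ := by
      rw [add_left_inj, add_left_inj, mul_right_inj' hu3]
    rintro (_ | ⟨x₁, y₁, h₁⟩) (_ | ⟨x₂, y₂, h₂⟩)
    any_goals rfl
    by_cases hxy : x₁ = x₂ ∧ y₁ = (C • W).toAffine.negY x₂ y₂
    · rw [Point.add_of_Y_eq hxy.1 hxy.2]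
      refine (Point.add_of_Y_eq (hX.2 hxy.1) ?_).symm
      rw [hN, hxy.1, hxy.2]
    · have hxy' : ¬ (C.u ^ 2 * x₁ + C.r = C.u ^ 2 * x₂ + C.r ∧
          C.u ^ 3 * y₁ + C.u ^ 2 * C.s * x₁ + C.t =
          W.toAffine.negY (C.u ^ 2 * x₂ + C.r) (C.u ^ 3 * y₂ + C.u ^ 2 * C.s * x₂ + C.t)) := by
        rintro ⟨hx, hy⟩
        obtain rfl := hX.1 hx
        rw [hN, hY] at hy
        exact hxy ⟨rfl, hy⟩
      -- Lines go to lines: a chord or tangent of slope `m` is carried to one of slope `u m + s`.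
      have hS : W.toAffine.slope (C.u ^ 2 * x₁ + C.r) (C.u ^ 2 * x₂ + C.r)
          (C.u ^ 3 * y₁ + C.u ^ 2 * C.s * x₁ + C.t) (C.u ^ 3 * y₂ + C.u ^ 2 * C.s * x₂ + C.t) =
          C.u * (C • W).toAffine.slope x₁ x₂ y₁ y₂ + C.s := by
        by_cases hx : x₁ = x₂
        · subst hx
          have hy : y₁ ≠ (C • W).toAffine.negY x₁ y₂ := fun h => hxy ⟨rfl, h⟩
          obtain rfl := Y_eq_of_Y_ne h₁.1 h₂.1 rfl hy
          rw [slope_of_Y_ne rfl hy, slope_of_Y_ne rfl (fun h => hxy' ⟨rfl, h⟩), hN]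
          have hd := sub_ne_zero.2 hy
          have hd' : (C.u : K) ^ 3 * y₁ + C.u ^ 2 * C.s * x₁ + C.t - (C.u ^ 3 *
              (C • W).toAffine.negY x₁ y₁ + C.u ^ 2 * C.s * x₁ + C.t) ≠ 0 := by
            rw [sub_ne_zero]
            exact fun h => hy (hY.1 h)
          rw [div_eq_iff hd']
          have e : (C.u : K) ^ 3 * y₁ + C.u ^ 2 * C.s * x₁ + C.t - (C.u ^ 3 *
              (C • W).toAffine.negY x₁ y₁ + C.u ^ 2 * C.s * x₁ + C.t) = C.u ^ 3 * (y₁ -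
              (C • W).toAffine.negY x₁ y₁) := by ring
          rw [e]
          have e' := div_mul_cancel₀ (3 * x₁ ^ 2 + 2 * (C • W).toAffine.a₂ * x₁ +
            (C • W).toAffine.a₄ - (C • W).toAffine.a₁ * y₁) hd
          generalize (_ / _ : K) = m at e' ⊢
          have e'' : 3 * (C.u ^ 2 * x₁ + C.r) ^ 2 + 2 * W.toAffine.a₂ * (C.u ^ 2 * x₁ + C.r) +
              W.toAffine.a₄ - W.toAffine.a₁ * (C.u ^ 3 * y₁ + C.u ^ 2 * C.s * x₁ + C.t) =
              C.u ^ 4 * (3 * x₁ ^ 2 + 2 * (C • W).toAffine.a₂ * x₁ + (C • W).toAffine.a₄ -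
                (C • W).toAffine.a₁ * y₁) +
              C.s * (C.u ^ 3 * (y₁ - (C • W).toAffine.negY x₁ y₁)) := by
            simp only [negY, variableChange_def, Units.val_inv_eq_inv_val]
            field_simp
            ring
          rw [e'', ← e']
          ring
        · rw [slope_of_X_ne hx, slope_of_X_ne (fun h => hx (hX.1 h))]
          have hd := sub_ne_zero.2 hx
          have hd' : (C.u : K) ^ 2 * x₁ + C.r - (C.u ^ 2 * x₂ + C.r) ≠ 0 :=
            sub_ne_zero.2 fun h => hx (hX.1 h)
          rw [div_eq_iff hd', mul_comm]
          field_simp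
          ring
      have hAX : C.u ^ 2 * (C • W).toAffine.addX x₁ x₂ ((C • W).toAffine.slope x₁ x₂ y₁ y₂) + C.r =
          W.toAffine.addX (C.u ^ 2 * x₁ + C.r) (C.u ^ 2 * x₂ + C.r)
            (C.u * (C • W).toAffine.slope x₁ x₂ y₁ y₂ + C.s) := by
        simp only [addX, variableChange_def, Units.val_inv_eq_inv_val]
        field_simp
        ring
      rw [Point.add_some hxy]
      refine Eq.trans ?_ (Point.add_some hxy').symm
      simp only [Point.some.injEq]
      rw [hS]
      refine ⟨hAX, ?_⟩
      rw [addY, addY, negAddY, negAddY, ← hN, ← hAX]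
      congr 1
      ring

theorem variableChangePoint_injective {W W' : WeierstrassCurve K} (C : VariableChange K)
    (h : W' = C • W) : Function.Injective (variableChangePoint C h) := by
  have hu : (C.u : K) ≠ 0 := C.u.ne_zero
  refine (injective_iff_map_eq_zero _).2 ?_
  rintro (_ | ⟨x, y, hP⟩) h0
  · rfl
  · exact absurd h0 (Point.some_ne_zero _)

end VariableChange

/-! ### The twist over `F(√α)` and the Galois action on its torsion -/

section Twist

open WeierstrassCurve

variable {F : Type*} [Field F] (E : WeierstrassCurve F)

/-- An automorphism acting trivially on the `N`-torsion of a curve acts trivially on the `N`-torsion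
of every curve isomorphic to it over the base field. -/
theorem galPoint_eq_self_of_variableChange {E E' : WeierstrassCurve F} (C : VariableChange F)
    (h : E' = C • E) (K : Type*) [Field K] [Algebra F K] (N : ℕ) (σ : K ≃ₐ[F] K)
    (hσ : ∀ P ∈ torsion E K N, galPoint E K σ P = P) :
    ∀ P ∈ torsion E' K N, galPoint E' K σ P = P := by
  classical
  have hC : E'.baseChange K = C.map (algebraMap F K) • E.baseChange K := by
    rw [h, WeierstrassCurve.baseChange, WeierstrassCurve.baseChange, map_variableChange]
  intro P hP
  rcases P with (_ | ⟨x, y, hxy⟩)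
  · rfl
  apply variableChangePoint_injective (C.map (algebraMap F K)) hC
  have hfP : variableChangePoint (C.map (algebraMap F K)) hC (.some x y hxy) ∈ torsion E K N := by
    rw [AddSubgroup.torsionBy.nsmul_iff] at hP ⊢
    have := congrArg (variableChangePoint (C.map (algebraMap F K)) hC)
      ((by convert hP) : N • (Affine.Point.some x y hxy) = 0)
    rw [map_nsmul, map_zero] at this
    convert this
  refine Eq.trans ?_ (hσ _ hfP)
  refine point_some_eq_some ?_ ?_ _ _ <;>
    simp [VariableChange.map]

/-- The shifts `-a₁/2` and `-a₃/2` complete the square, and the scaling `u = β⁻¹` absorbs the powers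
of `α = β²`. -/
theorem baseChange_quadraticTwist [CharZero F] (α : F) (K : Type*) [Field K] [Algebra F K]
    (β : Kˣ) (hβ : (β : K) ^ 2 = algebraMap F K α) :
    (quadraticTwist E α).baseChange K = (⟨β⁻¹, 0, algebraMap F K (-E.a₁ / 2),
      algebraMap F K (-E.a₃ / 2)⟩ : VariableChange K) • E.baseChange K := by
  have : CharZero K := charZero_of_injective_algebraMap (algebraMap F K).injective
  rw [variableChange_def]
  ext <;> simp only [quadraticTwist, WeierstrassCurve.baseChange, map_a₁, map_a₂, map_a₃, map_a₄,
    map_a₆, map_mul, map_pow, map_div₀, map_neg, map_ofNat, map_zero, inv_inv, ← hβ, b₂, b₄, b₆,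
    map_add] <;> field_simp <;> ring

/-- If `σ` acts trivially on `E[N]` and negates `√α`, then `σ` acts as `-1` on `E^α[N]`. -/
theorem galPoint_quadraticTwist_eq_neg [CharZero F] (α : F) (K : Type*) [Field K] [Algebra F K]
    (β : K) (hβ0 : β ≠ 0) (hβ : β ^ 2 = algebraMap F K α) (N : ℕ) (σ : K ≃ₐ[F] K) (hσβ : σ β = -β)
    (hσ : ∀ P ∈ torsion E K N, galPoint E K σ P = P) :
    ∀ P ∈ torsion (quadraticTwist E α) K N, galPoint (quadraticTwist E α) K σ P = -P := by
  classical
  have : CharZero K := charZero_of_injective_algebraMap (algebraMap F K).injective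
  have hC := baseChange_quadraticTwist E α K (Units.mk0 β hβ0) hβ
  generalize hCdef : (VariableChange.mk _ _ _ _ : VariableChange K) = C at hC
  intro P hP
  rcases P with (_ | ⟨x, y, hxy⟩)
  · rfl
  rw [← neg_eq_iff_eq_neg]
  apply variableChangePoint_injective C hC
  have hfP : variableChangePoint C hC (.some x y hxy) ∈ torsion E K N := by
    rw [AddSubgroup.torsionBy.nsmul_iff] at hP ⊢
    have := congrArg (variableChangePoint C hC)
      ((by convert hP) : N • (Affine.Point.some x y hxy) = 0)
    rw [map_nsmul, map_zero] at this
    convert this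
  -- The image point is `(x/β², y/β³ - (a₁/2) x/β² - a₃/2)`. Replacing `β` by `-β` changes only the
  -- term `y/β³`, which is negation on `E`.
  refine Eq.trans ?_ (hσ _ hfP)
  have h0 : (quadraticTwist E α).a₁ = 0 := rfl
  have h0' : (quadraticTwist E α).a₃ = 0 := rfl
  subst hCdef
  refine point_some_eq_some ?_ ?_ _ _
  · simp [hσβ]
  · simp [hσβ, h0, h0', WeierstrassCurve.baseChange]
    field_simp

theorem twist_neg_one_mem_range [CharZero F] (α : F) (β : AlgebraicClosure F) (hβ0 : β ≠ 0)
    (hβ : β ^ 2 = algebraMap F _ α) (N : ℕ) (σ : AlgebraicClosure F ≃ₐ[F] AlgebraicClosure F)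
    (hσβ : σ β = -β)
    (hσ : ∀ P ∈ torsion E (AlgebraicClosure F) N, galPoint E (AlgebraicClosure F) σ P = P) :
    -1 ∈ (galRep (quadraticTwist E α) N).range := by
  refine ⟨σ, Units.ext (LinearMap.ext fun P => Subtype.ext ?_)⟩
  exact galPoint_quadraticTwist_eq_neg E α _ β hβ0 hβ N σ hσβ hσ P P.2

/-- By infinite Galois theory, a root outside `F(E[N])` is moved, hence negated, by some `σ` fixing
`F(E[N])`; such a `σ` acts as `-1` on the torsion of the twist. -/
theorem mem_divisionField_of_twist [CharZero F] (N : ℕ) (α : Fˣ)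
    (hα : TwistImageMissesNegOne E N α) (β : AlgebraicClosure F)
    (hβ : β ^ 2 = algebraMap F (AlgebraicClosure F) α) : β ∈ divisionField E N := by
  have hβ0 : β ≠ 0 := by
    rintro rfl
    apply α.ne_zero
    apply (algebraMap F (AlgebraicClosure F)).injective
    rw [← hβ]
    simp
  by_contra hmem
  obtain ⟨σ, hσ, hσβ⟩ : ∃ σ ∈ (divisionField E N).fixingSubgroup, σ β ≠ β := by
    by_contra! h
    apply hmem
    rw [← InfiniteGalois.fixedField_fixingSubgroup (divisionField E N)]
    exact fun σ => h σ σ.2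
  refine hα (twist_neg_one_mem_range E (α : F) β hβ0 hβ N σ ?_ ?_)
  · have : (σ β) ^ 2 = β ^ 2 := by rw [← map_pow, hβ, AlgEquiv.commutes]
    exact (sq_eq_sq_iff_eq_or_eq_neg.1 this).resolve_left hσβ
  · rintro (_ | ⟨x, y, h⟩) hP
    · rfl
    · rw [IntermediateField.mem_fixingSubgroup_iff] at hσ
      exact point_some_eq_some (hσ x (subset_adjoin _ _ ⟨x, y, h, hP, Or.inl rfl⟩))
        (hσ y (subset_adjoin _ _ ⟨x, y, h, hP, Or.inr rfl⟩)) _ _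

end Twist
end EllipticTwist

namespace EllipticTwist

open IsDedekindDomain IntermediateField

/-! ### Good reduction is injective on prime-to-residue torsion -/

section Reduction

open WeierstrassCurve WeierstrassCurve.Affine

variable {K : Type*} [Field K] {Γ₀ : Type*} [LinearOrderedCommGroupWithZero Γ₀]
  (v : Valuation K Γ₀)

/-- The coefficients of the Weierstrass equation are integral for the valuation `v`. -/
structure IsIntegralAt (W : WeierstrassCurve K) : Prop where
  a₁ : v W.a₁ ≤ 1
  a₂ : v W.a₂ ≤ 1
  a₃ : v W.a₃ ≤ 1
  a₄ : v W.a₄ ≤ 1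
  a₆ : v W.a₆ ≤ 1

variable {v}

theorem val_mul_le_one {x y : K} (hx : v x ≤ 1) (hy : v y ≤ 1) : v (x * y) ≤ 1 := by
  rw [map_mul]; exact mul_le_one' hx hy

theorem val_mul_lt_one {x y : K} (hx : v x ≤ 1) (hy : v y < 1) : v (x * y) < 1 := by
  rw [map_mul]; exact mul_lt_one_of_nonneg_of_lt_one_right hx zero_le hy

theorem val_pow_le_one {x : K} (hx : v x ≤ 1) (n : ℕ) : v (x ^ n) ≤ 1 := by
  rw [map_pow]; exact pow_le_one' hx n

theorem val_add_le {x y : K} {c : Γ₀} (hx : v x ≤ c) (hy : v y ≤ c) : v (x + y) ≤ c :=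
  v.map_add_le hx hy

theorem val_sub_le {x y : K} {c : Γ₀} (hx : v x ≤ c) (hy : v y ≤ c) : v (x - y) ≤ c :=
  (v.map_sub x y).trans (max_le hx hy)

theorem val_natCast_le_one (n : ℕ) : v (n : K) ≤ 1 := by
  induction n with
  | zero => simp
  | succ n ih => rw [Nat.cast_succ]; exact val_add_le ih v.map_one.le

theorem val_ofNat_le_one (n : ℕ) [n.AtLeastTwo] : v (OfNat.ofNat n : K) ≤ 1 :=
  val_natCast_le_one n

theorem val_one_add_of_lt {x : K} (hx : v x < 1) : v (1 + x) = 1 :=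
  v.map_one_add_of_lt hx

theorem val_mul_le {x y : K} {c : Γ₀} (hx : v x ≤ 1) (hy : v y ≤ c) : v (x * y) ≤ c := by
  rw [map_mul]; exact (mul_le_mul' hx hy).trans_eq (one_mul c)

/-- A Weierstrass curve with a singular point has discriminant zero. -/
theorem discriminant_eq_zero_of_singular {k : Type*} [Field k] {W : WeierstrassCurve k} {x y : k}
    (h : W.toAffine.Equation x y) (hY : 2 * y + W.a₁ * x + W.a₃ = 0)
    (hX : 3 * x ^ 2 + 2 * W.a₂ * x + W.a₄ - W.a₁ * y = 0) : W.Δ = 0 := by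
  by_contra hΔ
  have := (equation_iff_nonsingular_of_Δ_ne_zero hΔ).1 h
  rw [nonsingular_iff'] at this
  rcases this.2 with h | h
  · exact h (by linear_combination -hX)
  · exact h hY

/-- If `ℓ` is the slope of the line through two integral points of an integral Weierstrass curve
with unit discriminant which are opposite modulo the maximal ideal, then `ℓ` is not integral. -/
theorem one_lt_val_slope {W : WeierstrassCurve K} (hW : IsIntegralAt v W) (hΔ : v W.Δ = 1)
    {x y x' y' ℓ : K} (hx : v x ≤ 1) (hy : v y ≤ 1) (hx' : v x' ≤ 1) (hy' : v y' ≤ 1)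
    (h : W.toAffine.Equation x y) (hxx : v (x - x') < 1) (hD : v (y + y' + W.a₁ * x + W.a₃) < 1)
    (h1 : ℓ * (x - x') = y - y')
    (h2 : ℓ * (y + y' + W.a₁ * x + W.a₃) =
      x ^ 2 + x * x' + x' ^ 2 + W.a₂ * (x + x') + W.a₄ - W.a₁ * y') : 1 < v ℓ := by
  by_contra! hℓ
  -- Were `ℓ` integral, `h1` and `h2` could be reduced modulo the maximal ideal. Their left sides
  -- vanish there, so both partial derivatives vanish at the reduced point, against the unit
  -- discriminant.
  let A := v.valuationSubring
  have hres (a : A) : IsLocalRing.residue A a = 0 ↔ v (a : K) < 1 := by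
    rw [IsLocalRing.residue_eq_zero_iff, ValuationSubring.valuation_lt_one_iff]
    exact (v.isEquiv_valuation_valuationSubring.lt_one_iff_lt_one).symm
  let W₀ : WeierstrassCurve A :=
    ⟨⟨W.a₁, hW.a₁⟩, ⟨W.a₂, hW.a₂⟩, ⟨W.a₃, hW.a₃⟩, ⟨W.a₄, hW.a₄⟩, ⟨W.a₆, hW.a₆⟩⟩
  have hW₀ : W₀.map A.subtype = W := rfl
  obtain ⟨x, rfl⟩ : ∃ a : A, (a : K) = x := ⟨⟨x, hx⟩, rfl⟩
  obtain ⟨y, rfl⟩ : ∃ a : A, (a : K) = y := ⟨⟨y, hy⟩, rfl⟩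
  obtain ⟨x', rfl⟩ : ∃ a : A, (a : K) = x' := ⟨⟨x', hx'⟩, rfl⟩
  obtain ⟨y', rfl⟩ : ∃ a : A, (a : K) = y' := ⟨⟨y', hy'⟩, rfl⟩
  obtain ⟨ℓ, rfl⟩ : ∃ a : A, (a : K) = ℓ := ⟨⟨ℓ, hℓ⟩, rfl⟩
  let ρ := IsLocalRing.residue A
  have e0 : ρ (x - x') = 0 := (hres _).2 hxx
  have e1 : ρ (y + y' + W₀.a₁ * x + W₀.a₃) = 0 := (hres _).2 hD
  have e2 : ρ (ℓ * (x - x')) = ρ (y - y') := congrArg ρ (Subtype.ext h1)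
  have e3 : ρ (ℓ * (y + y' + W₀.a₁ * x + W₀.a₃)) = ρ (x ^ 2 + x * x' + x' ^ 2 +
      W₀.a₂ * (x + x') + W₀.a₄ - W₀.a₁ * y') := congrArg ρ (Subtype.ext h2)
  have e4 : W₀.toAffine.Equation x y := by
    rw [equation_iff] at h ⊢
    exact Subtype.ext h
  have e5 : (W₀.map ρ).toAffine.Equation (ρ x) (ρ y) := e4.map ρ
  rw [map_mul, e0, mul_zero] at e2
  rw [map_mul, e1, mul_zero] at e3
  simp only [map_sub, map_add, map_mul, map_pow] at e0 e1 e2 e3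
  have hΔ0 : (W₀.map ρ).Δ = 0 := by
    refine discriminant_eq_zero_of_singular e5 ?_ ?_
    · simp only [map_a₁, map_a₃]
      linear_combination e1 - e2
    · simp only [map_a₁, map_a₂, map_a₄]
      linear_combination -e3 + (2 * ρ x + ρ x' + ρ W₀.a₂) * e0 + ρ W₀.a₁ * e2
  rw [map_Δ, hres] at hΔ0
  apply hΔ0.ne
  rw [← hΔ, ← hW₀, map_Δ]
  rfl

/-- The difference of two distinct integral points with the same reduction reduces to zero. -/
theorem exists_sub_eq_some [DecidableEq K] {W : WeierstrassCurve K} (hW : IsIntegralAt v W)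
    (hΔ : v W.Δ = 1) {x y x' y' : K} (hP : W.toAffine.Nonsingular x y)
    (hP' : W.toAffine.Nonsingular x' y') (hx : v x ≤ 1) (hy : v y ≤ 1) (hx' : v x' ≤ 1)
    (hy' : v y' ≤ 1) (hxx : v (x - x') < 1) (hyy : v (y - y') < 1)
    (hne : (.some x y hP : W.toAffine.Point) ≠ .some x' y' hP') :
    ∃ (x₃ y₃ : K) (h₃ : W.toAffine.Nonsingular x₃ y₃), 1 < v x₃ ∧
      (.some x y hP : W.toAffine.Point) - .some x' y' hP' = .some x₃ y₃ h₃ := by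
  have hxy : ¬ (x = x' ∧ y = W.toAffine.negY x' (W.toAffine.negY x' y')) := by
    rw [negY_negY]
    rintro ⟨rfl, rfl⟩
    exact hne rfl
  have hn' := (nonsingular_neg x' y').2 hP'
  rw [sub_eq_add_neg, Point.neg_some, Point.add_some hxy]
  refine ⟨_, _, _, ?_, rfl⟩
  have hD : v (y + W.toAffine.negY x' y' + W.a₁ * x + W.a₃) < 1 := by
    have : y + W.toAffine.negY x' y' + W.a₁ * x + W.a₃ = (y - y') + W.a₁ * (x - x') := by
      rw [negY]; ring
    rw [this]
    exact v.map_add_lt hyy (val_mul_lt_one hW.a₁ hxx)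
  have hny : v (W.toAffine.negY x' y') ≤ 1 := by
    rw [negY]
    exact val_sub_le (val_sub_le (by rwa [v.map_neg]) (val_mul_le_one hW.a₁ hx')) hW.a₃
  have hℓ : 1 < v (W.toAffine.slope x x' y (W.toAffine.negY x' y')) := by
    have E1 := (equation_iff' _ _).1 hP.1
    have E2 := (equation_iff' _ _).1 hn'.1
    by_cases h : x = x'
    · subst h
      have hyn : y ≠ W.toAffine.negY x (W.toAffine.negY x y') := fun h => hxy ⟨rfl, h⟩
      obtain hyy' := Y_eq_of_Y_ne hP.1 hn'.1 rfl hyn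
      refine one_lt_val_slope hW hΔ hx hy hx' hny hP.1 hxx hD ?_ ?_
      · rw [← hyy']; ring
      · rw [← hyy'] at hyn ⊢
        rw [slope_of_Y_ne rfl hyn]
        have := div_mul_cancel₀ (3 * x ^ 2 + 2 * W.toAffine.a₂ * x + W.toAffine.a₄ -
          W.toAffine.a₁ * y) (sub_ne_zero.2 hyn)
        rw [show y + y + W.a₁ * x + W.a₃ = y - W.toAffine.negY x y by rw [negY]; ring, this]
        ring
    · refine one_lt_val_slope hW hΔ hx hy hx' hny hP.1 hxx hD ?_ ?_
      · rw [slope_of_X_ne h, div_mul_cancel₀ _ (sub_ne_zero.2 h)]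
      · rw [slope_of_X_ne h]
        have h := sub_ne_zero.2 h
        field_simp
        linear_combination E1 - E2
  set ℓ := W.toAffine.slope x x' y (W.toAffine.negY x' y')
  -- As `v ℓ > 1` and everything else is integral, `ℓ²` strictly dominates the x-coordinate.
  rw [addX, show ℓ ^ 2 + W.a₁ * ℓ - W.a₂ - x - x' = ℓ ^ 2 + (W.a₁ * ℓ - W.a₂ - x - x') by ring]
  have h1 : v ℓ < v (ℓ ^ 2) := by
    rw [map_pow, sq]
    exact lt_mul_of_one_lt_left (zero_lt_one.trans hℓ) hℓ
  rw [v.map_add_eq_of_lt_left]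
  · exact hℓ.trans h1
  · refine lt_of_le_of_lt ?_ h1
    exact val_sub_le (val_sub_le (val_sub_le (val_mul_le hW.a₁ le_rfl) (hW.a₂.trans hℓ.le))
      (hx.trans hℓ.le)) (hx'.trans hℓ.le)

/-- `y` is a root of a monic quadratic with coefficients integral at `v`; if `v y > 1`, the term
`y²` would dominate. -/
theorem val_y_le_one {W : WeierstrassCurve K} (hW : IsIntegralAt v W) {x y : K}
    (h : W.toAffine.Equation x y) (hx : v x ≤ 1) : v y ≤ 1 := by
  by_contra! hy
  rw [equation_iff] at h
  have h1 : v y < v (y ^ 2) := by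
    rw [map_pow, sq]
    exact lt_mul_of_one_lt_left (zero_lt_one.trans hy) hy
  have h2 : y ^ 2 = x ^ 3 + W.a₂ * x ^ 2 + W.a₄ * x + W.a₆ - W.a₁ * x * y - W.a₃ * y := by
    linear_combination h
  have h3 : v (y ^ 2) ≤ v y := by
    rw [h2]
    refine val_sub_le (val_sub_le (le_trans ?_ hy.le) ?_) ?_
    · exact val_add_le (val_add_le (val_add_le (val_pow_le_one hx 3)
        (val_mul_le_one hW.a₂ (val_pow_le_one hx 2))) (val_mul_le_one hW.a₄ hx)) hW.a₆
    · exact val_mul_le (val_mul_le_one hW.a₁ hx) le_rfl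
    · exact val_mul_le hW.a₃ le_rfl
  exact (h1.trans_le h3).false

/-- When `v x > 1`, the terms `x³` and `y²` dominate the two sides of the equation, so `v y ^ 2 = v
x ^ 3`. -/
theorem val_div_of_one_lt {W : WeierstrassCurve K} (hW : IsIntegralAt v W) {x y : K}
    (h : W.toAffine.Equation x y) (hx : 1 < v x) :
    y ≠ 0 ∧ v (x / y) < 1 ∧ v y⁻¹ = v (x / y) ^ 3 := by
  rw [equation_iff] at h
  have hx0 : v x ≠ 0 := (zero_lt_one.trans hx).ne'
  have hx1 : v x ≤ v x ^ 2 := le_self_pow hx.le two_ne_zero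
  have hR : v (x ^ 3 + W.a₂ * x ^ 2 + W.a₄ * x + W.a₆) = v x ^ 3 := by
    rw [show x ^ 3 + W.a₂ * x ^ 2 + W.a₄ * x + W.a₆ = x ^ 3 + (W.a₂ * x ^ 2 + W.a₄ * x + W.a₆) by
      ring, v.map_add_eq_of_lt_left, map_pow]
    refine lt_of_le_of_lt (b := v x ^ 2) ?_ ?_
    · refine val_add_le (val_add_le (val_mul_le hW.a₂ (map_pow v x 2).le)
        (val_mul_le hW.a₄ hx1)) (hW.a₆.trans (hx.le.trans hx1))
    · rw [map_pow]
      exact pow_lt_pow_right₀ hx (by norm_num)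
  have hxy : v x < v y := by
    by_contra! hle
    have : v (y ^ 2 + W.a₁ * x * y + W.a₃ * y) ≤ v x ^ 2 := by
      refine val_add_le (val_add_le ?_ ?_) ?_
      · rw [map_pow]; exact pow_le_pow_left₀ zero_le hle 2
      · rw [mul_assoc]
        refine val_mul_le hW.a₁ ?_
        rw [map_mul, sq]
        exact mul_le_mul_right hle _
      · exact val_mul_le hW.a₃ (hle.trans hx1)
    rw [h, hR] at this
    exact (pow_lt_pow_right₀ hx (by norm_num : 2 < 3)).not_ge this
  have hy1 := hx.trans hxy
  have hy0 : v y ≠ 0 := (zero_lt_one.trans hy1).ne'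
  have hL : v (y ^ 2 + W.a₁ * x * y + W.a₃ * y) = v y ^ 2 := by
    rw [add_assoc, v.map_add_eq_of_lt_left, map_pow]
    rw [← add_mul, map_mul, map_pow, sq]
    refine mul_lt_mul_of_pos_right ?_ (zero_lt_one.trans hy1)
    exact lt_of_le_of_lt (val_add_le (val_mul_le hW.a₁ le_rfl) (hW.a₃.trans hx.le)) hxy
  have hE : v y ^ 2 = v x ^ 3 := by rw [← hL, h, hR]
  refine ⟨(v.ne_zero_iff).1 hy0, ?_, ?_⟩
  · rw [map_div₀]
    exact (div_lt_one₀ (zero_lt_one.trans hy1)).2 hxy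
  · rw [map_inv₀, map_div₀, div_pow, ← hE]
    field_simp

/-- The parameter `x / y` at the origin of a Weierstrass curve. -/
def originParam {W : WeierstrassCurve K} : W.toAffine.Point → K
  | .zero => 0
  | .some x y _ => x / y

variable (v) in
/-- The points reducing to the origin, with parameter at most `τ`. -/
def NearOrigin {W : WeierstrassCurve K} (τ : Γ₀) : W.toAffine.Point → Prop
  | .zero => True
  | .some x y _ => 1 < v x ∧ v (x / y) ≤ τ

/-- With `t = x/y`, `w = 1/y` and `s = a₁ t + a₃ w`, the negative has parameter `-t/(1 + s)`. Since
`v s ≤ τ < 1`, negation on the curve differs from negation of the parameter by `s t/(1 + s)`, of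
second order. -/
theorem val_neg_param_add {W : WeierstrassCurve K} (hW : IsIntegralAt v W) {x y : K}
    (h : W.toAffine.Equation x y) (hx : 1 < v x) {τ : Γ₀} (hτ1 : τ < 1) (hτ : v (x / y) ≤ τ) :
    v (x / W.toAffine.negY x y) ≤ τ ∧ v (x / W.toAffine.negY x y + x / y) ≤ τ ^ 2 := by
  obtain ⟨hy0, ht1, hw⟩ := val_div_of_one_lt hW h hx
  set t := x / y with ht
  set w := y⁻¹ with hw'
  have hwτ : v w ≤ τ := by
    rw [hw]
    exact (pow_le_of_le_one zero_le ht1.le three_ne_zero).trans hτ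
  have hs : v (W.a₁ * t + W.a₃ * w) ≤ τ :=
    val_add_le (val_mul_le hW.a₁ hτ) (val_mul_le hW.a₃ hwτ)
  have hu := val_one_add_of_lt (hs.trans_lt hτ1)
  set s := W.a₁ * t + W.a₃ * w with hs'
  have hu0 : 1 + s ≠ 0 := by
    rw [← v.ne_zero_iff, hu]
    exact one_ne_zero
  have hn : W.toAffine.negY x y = -(y * (1 + s)) := by
    rw [negY, hs', ht, hw']
    field_simp
    ring
  have e1 : x / W.toAffine.negY x y = -(t / (1 + s)) := by
    rw [hn, ht]
    field_simp
  have e2 : x / W.toAffine.negY x y + t = s * t / (1 + s) := by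
    rw [e1]
    field_simp
    ring
  refine ⟨?_, ?_⟩
  · rw [e1, v.map_neg, map_div₀, hu, div_one]
    exact hτ
  · rw [e2, map_div₀, hu, div_one, map_mul, sq]
    exact mul_le_mul' hs hτ

/-- The slope of the chord through two points near the origin, in the coordinates `t = x / y` and
`w = 1 / y`. -/
theorem exists_chord [DecidableEq K] {W : WeierstrassCurve K} (hW : IsIntegralAt v W)
    {x₁ y₁ x₂ y₂ : K} (h₁ : W.toAffine.Equation x₁ y₁) (h₂ : W.toAffine.Equation x₂ y₂)
    (hxy : ¬ (x₁ = x₂ ∧ y₁ = W.toAffine.negY x₂ y₂)) (hx₁ : 1 < v x₁) (hx₂ : 1 < v x₂)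
    {τ : Γ₀} (hτ1 : τ < 1) (hτ₁ : v (x₁ / y₁) ≤ τ) (hτ₂ : v (x₂ / y₂) ≤ τ) :
    ∃ l : K, v l ≤ τ ^ 2 ∧ W.toAffine.slope x₁ x₂ y₁ y₂ =
      -l * (y₁ - W.toAffine.slope x₁ x₂ y₁ y₂ * x₁) := by
  obtain ⟨hy₁, ht₁, hw₁⟩ := val_div_of_one_lt hW h₁ hx₁
  obtain ⟨hy₂, ht₂, hw₂⟩ := val_div_of_one_lt hW h₂ hx₂
  have E₁ := (equation_iff _ _).1 h₁
  have E₂ := (equation_iff _ _).1 h₂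
  set t₁ := x₁ / y₁ with ht₁'
  set t₂ := x₂ / y₂ with ht₂'
  set w₁ := y₁⁻¹ with hw₁'
  set w₂ := y₂⁻¹ with hw₂'
  have hττ : τ ^ 2 ≤ τ := pow_le_of_le_one zero_le hτ1.le two_ne_zero
  have hw₁τ : v w₁ ≤ τ ^ 2 := by
    rw [hw₁]
    exact (pow_le_pow_right_of_le_one' ht₁.le (by norm_num : 2 ≤ 3)).trans
      (pow_le_pow_left₀ zero_le hτ₁ 2)
  have hw₂τ : v w₂ ≤ τ ^ 2 := by
    rw [hw₂]
    exact (pow_le_pow_right_of_le_one' ht₂.le (by norm_num : 2 ≤ 3)).trans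
      (pow_le_pow_left₀ zero_le hτ₂ 2)
  have hττ1 : τ ^ 2 ≤ 1 := hττ.trans hτ1.le
  have hmul {a b : K} (ha : v a ≤ τ) (hb : v b ≤ τ) : v (a * b) ≤ τ ^ 2 := by
    rw [map_mul, sq]
    exact mul_le_mul' ha hb
  -- In the coordinates `t`, `w` the curve is `w + a₁tw + a₃w² = t³ + a₂t²w + a₄tw² + a₆w³`.
  -- Subtracting its two instances gives `(w₂ - w₁)(1 + r) = num (t₂ - t₁)`. As `1 + r` is a unit,
  -- `num / (1 + r)` is the chord slope, and it gives the tangent slope when the points coincide.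
  set num := t₁ ^ 2 + t₁ * t₂ + t₂ ^ 2 + (t₁ + t₂) * (W.a₂ * w₂) + (W.a₄ * w₂) * w₂ - W.a₁ * w₂
    with hnum
  set r := W.a₁ * t₁ + W.a₃ * (w₁ + w₂) - W.a₂ * t₁ ^ 2 - W.a₄ * (t₁ * (w₁ + w₂)) -
    W.a₆ * (w₁ ^ 2 + w₁ * w₂ + w₂ ^ 2) with hr
  have hww := val_add_le (hw₁τ.trans hττ) (hw₂τ.trans hττ)
  have hvr : v r ≤ τ := by
    refine val_sub_le (val_sub_le (val_sub_le (val_add_le (val_mul_le hW.a₁ hτ₁)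
      (val_mul_le hW.a₃ hww)) (val_mul_le hW.a₂ ?_)) (val_mul_le hW.a₄ ((hmul hτ₁ hww).trans hττ)))
      (val_mul_le hW.a₆ (val_add_le (val_add_le ?_ ?_) ?_))
    · rw [sq]; exact (hmul hτ₁ hτ₁).trans hττ
    · rw [sq]; exact (hmul (hw₁τ.trans hττ) (hw₁τ.trans hττ)).trans hττ
    · exact (hmul (hw₁τ.trans hττ) (hw₂τ.trans hττ)).trans hττ
    · rw [sq]; exact (hmul (hw₂τ.trans hττ) (hw₂τ.trans hττ)).trans hττ
  have hvn : v num ≤ τ ^ 2 := by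
    refine val_sub_le (val_add_le (val_add_le (val_add_le (val_add_le ?_ (hmul hτ₁ hτ₂)) ?_) ?_) ?_)
      (val_mul_le hW.a₁ hw₂τ)
    · rw [sq]; exact hmul hτ₁ hτ₁
    · rw [sq]; exact hmul hτ₂ hτ₂
    · exact val_mul_le ((val_add_le hτ₁ hτ₂).trans hτ1.le) (val_mul_le hW.a₂ hw₂τ)
    · exact val_mul_le (val_mul_le_one hW.a₄ (hw₂τ.trans hττ1)) hw₂τ
  have hden := val_one_add_of_lt (hvr.trans_lt hτ1)
  have hden0 : 1 + r ≠ 0 := by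
    rw [← v.ne_zero_iff, hden]
    exact one_ne_zero
  obtain ⟨l, hl⟩ : ∃ l, l * (1 + r) = num := ⟨num / (1 + r), div_mul_cancel₀ _ hden0⟩
  refine ⟨l, ?_, ?_⟩
  · rw [← hl, map_mul, hden, mul_one] at hvn
    exact hvn
  by_cases hx : x₁ = x₂
  · subst hx
    have hy : y₁ ≠ W.toAffine.negY x₁ y₂ := fun h => hxy ⟨rfl, h⟩
    obtain rfl := Y_eq_of_Y_ne h₁ h₂ rfl hy
    rw [slope_of_Y_ne rfl hy]
    have hs := div_mul_cancel₀ (3 * x₁ ^ 2 + 2 * W.toAffine.a₂ * x₁ + W.toAffine.a₄ -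
      W.toAffine.a₁ * y₁) (sub_ne_zero.2 hy)
    generalize (_ / _ : K) = ℓ at hs ⊢
    have hd := sub_ne_zero.2 hy
    rw [negY] at hs hd
    have hl' : l * (y₁ ^ 2 + W.a₁ * x₁ * y₁ + 2 * W.a₃ * y₁ - W.a₂ * x₁ ^ 2 - 2 * W.a₄ * x₁ -
        3 * W.a₆) = 3 * x₁ ^ 2 + 2 * W.a₂ * x₁ + W.a₄ - W.a₁ * y₁ := by
      rw [hr, hnum, ht₁', hw₁', ht₂', hw₂'] at hl
      field_simp at hl
      linear_combination hl
    rw [← sub_eq_zero]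
    refine (mul_eq_zero.1 ?_).resolve_left hd
    linear_combination (1 - l * x₁) * hs - hl' + 3 * l * E₁
  · rw [slope_of_X_ne hx]
    have hd := sub_ne_zero.2 hx
    have hs := div_mul_cancel₀ (y₁ - y₂) hd
    generalize (_ / _ : K) = ℓ at hs ⊢
    have hw : w₂ - w₁ = l * (t₂ - t₁) := by
      refine mul_right_cancel₀ hden0 ?_
      have g {x y : K} (hy : y ≠ 0) (E : y ^ 2 + W.a₁ * x * y + W.a₃ * y =
          x ^ 3 + W.a₂ * x ^ 2 + W.a₄ * x + W.a₆) : y⁻¹ + W.a₁ * (x / y) * y⁻¹ + W.a₃ * y⁻¹ ^ 2 =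
          (x / y) ^ 3 + W.a₂ * (x / y) ^ 2 * y⁻¹ + W.a₄ * (x / y) * y⁻¹ ^ 2 + W.a₆ * y⁻¹ ^ 3 := by
        field_simp
        linear_combination E
      rw [mul_right_comm, hl, hr, hnum]
      linear_combination g hy₂ E₂ - g hy₁ E₁
    have hw' : y₁ - y₂ = l * (x₂ * y₁ - x₁ * y₂) := by
      rw [ht₁', hw₁', ht₂', hw₂'] at hw
      field_simp at hw
      linear_combination hw
    rw [← sub_eq_zero]
    refine (mul_eq_zero.1 ?_).resolve_left hd
    linear_combination (1 - l * x₁) * hs + hw'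

/-- The sum of the parameters of the three points on a line, in terms of the slope `l` and the
constant term `m` of the line in the coordinates `t = x / y` and `w = 1 / y`. -/
theorem sum_param_line {a₁ a₂ a₃ a₄ a₆ x₁ x₂ x₃ ℓ ν l m : K}
    (e₁ : x₁ + x₂ + x₃ = ℓ ^ 2 + a₁ * ℓ - a₂)
    (e₂ : x₁ * x₂ + x₁ * x₃ + x₂ * x₃ = a₄ - 2 * ℓ * ν - a₁ * ν - a₃ * ℓ)
    (e₃ : x₁ * x₂ * x₃ = ν ^ 2 + a₃ * ν - a₆) (hm : m * ν = 1) (hl : ℓ = -l * ν) :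
    (ℓ * x₁ + ν) * (ℓ * x₂ + ν) * (ℓ * x₃ + ν) =
      ν ^ 3 * (1 + a₂ * l + a₄ * l ^ 2 + a₆ * l ^ 3) ∧
    x₁ * (ℓ * x₂ + ν) * (ℓ * x₃ + ν) + x₂ * (ℓ * x₁ + ν) * (ℓ * x₃ + ν) +
      x₃ * (ℓ * x₁ + ν) * (ℓ * x₂ + ν) =
      ν ^ 3 * (a₁ * l + a₃ * l ^ 2 - a₂ * m - 2 * a₄ * (l * m) - 3 * a₆ * (l ^ 2 * m)) := by
  subst hl
  have hν : ν ≠ 0 := right_ne_zero_of_mul (hm.trans_ne one_ne_zero)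
  obtain rfl : m = ν⁻¹ := eq_inv_of_mul_eq_one_left hm
  constructor
  · linear_combination (-l * ν) ^ 3 * e₃ + (-l * ν) ^ 2 * ν * e₂ + (-l * ν) * ν ^ 2 * e₁
  · field_simp
    linear_combination 3 * l ^ 2 * e₃ - 2 * l * e₂ + e₁

/-- Vieta for the cubic obtained by substituting the line `Y = ℓ X + ν` into the Weierstrass
equation. -/
theorem slope_vieta [DecidableEq K] {W : WeierstrassCurve K} {x₁ y₁ x₂ y₂ : K}
    (h₁ : W.toAffine.Equation x₁ y₁) (h₂ : W.toAffine.Equation x₂ y₂)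
    (hxy : ¬ (x₁ = x₂ ∧ y₁ = W.toAffine.negY x₂ y₂)) {ℓ x₃ ν : K}
    (hℓ : ℓ = W.toAffine.slope x₁ x₂ y₁ y₂) (hx₃ : x₃ = W.toAffine.addX x₁ x₂ ℓ)
    (hν : ν = y₁ - ℓ * x₁) :
    x₁ + x₂ + x₃ = ℓ ^ 2 + W.a₁ * ℓ - W.a₂ ∧
    x₁ * x₂ + x₁ * x₃ + x₂ * x₃ = W.a₄ - 2 * ℓ * ν - W.a₁ * ν - W.a₃ * ℓ ∧
    x₁ * x₂ * x₃ = ν ^ 2 + W.a₃ * ν - W.a₆ := by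
  have h := addPolynomial_slope h₁ h₂ hxy
  rw [← hℓ, ← hx₃, addPolynomial_eq, neg_inj, Cubic.prod_X_sub_C_eq, Cubic.toPoly_injective,
    Cubic.mk.injEq] at h
  obtain ⟨-, hb, hc, hd⟩ := h
  subst hν
  exact ⟨by linear_combination hb, by linear_combination -hc, by linear_combination hd⟩

/-- The parameter at the origin is additive to first order. -/
theorem NearOrigin.add [DecidableEq K] {W : WeierstrassCurve K} (hW : IsIntegralAt v W) {τ : Γ₀}
    (hτ1 : τ < 1) {P Q : W.toAffine.Point} (hP : NearOrigin v τ P) (hQ : NearOrigin v τ Q) :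
    NearOrigin v τ (P + Q) ∧ v (originParam (P + Q) - originParam P - originParam Q) ≤ τ ^ 2 := by
  have hττ : τ ^ 2 ≤ τ := pow_le_of_le_one zero_le hτ1.le two_ne_zero
  rcases P with (_ | ⟨x₁, y₁, h₁⟩)
  · rw [← Point.zero_def, zero_add]
    exact ⟨hQ, by simp [originParam]⟩
  rcases Q with (_ | ⟨x₂, y₂, h₂⟩)
  · rw [← Point.zero_def, add_zero]
    exact ⟨hP, by simp [originParam]⟩
  obtain ⟨hx₁, hτ₁⟩ := hP
  obtain ⟨hx₂, hτ₂⟩ := hQ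
  by_cases hxy : x₁ = x₂ ∧ y₁ = W.toAffine.negY x₂ y₂
  · rw [Point.add_of_Y_eq hxy.1 hxy.2]
    refine ⟨trivial, ?_⟩
    obtain ⟨rfl, rfl⟩ := hxy
    simp only [originParam]
    rw [← v.map_neg]
    refine le_trans (le_of_eq ?_) (val_neg_param_add hW h₂.1 hx₂ hτ1 hτ₂).2
    congr 1
    ring
  rw [Point.add_some hxy]
  obtain ⟨hy₁, -, -⟩ := val_div_of_one_lt hW h₁.1 hx₁
  obtain ⟨hy₂, -, -⟩ := val_div_of_one_lt hW h₂.1 hx₂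
  obtain ⟨l, hvl, hl⟩ := exists_chord hW h₁.1 h₂.1 hxy hx₁ hx₂ hτ1 hτ₁ hτ₂
  have h₃ := (nonsingular_negAdd h₁ h₂ hxy).1
  have hline : y₂ = W.toAffine.slope x₁ x₂ y₁ y₂ * (x₂ - x₁) + y₁ := by
    by_cases hx : x₁ = x₂
    · rw [hx, sub_self, mul_zero, zero_add]
      exact (Y_eq_of_Y_ne h₁.1 h₂.1 hx fun h => hxy ⟨hx, h⟩).symm
    · rw [slope_of_X_ne hx]
      have := sub_ne_zero.2 hx
      field_simp
      ring
  set ℓ := W.toAffine.slope x₁ x₂ y₁ y₂ with hℓ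
  set ν := y₁ - ℓ * x₁ with hν
  set x₃ := W.toAffine.addX x₁ x₂ ℓ with hx₃
  set y₃ := W.toAffine.negAddY x₁ x₂ y₁ ℓ with hy₃
  obtain ⟨e₁, e₂, e₃⟩ := slope_vieta h₁.1 h₂.1 hxy hℓ hx₃ hν
  have hy₁' : ℓ * x₁ + ν = y₁ := by rw [hν]; ring
  have hy₂' : ℓ * x₂ + ν = y₂ := by rw [hν, hline]; ring
  have hy₃' : ℓ * x₃ + ν = y₃ := by rw [hν, hy₃, negAddY, hx₃]; ring
  have hν0 : ν ≠ 0 := by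
    intro h0
    rw [h0, mul_zero] at hl
    rw [hl, h0, zero_mul, zero_add] at hy₁'
    exact hy₁ hy₁'.symm
  obtain ⟨m, hm⟩ : ∃ m, m * ν = 1 := ⟨ν⁻¹, inv_mul_cancel₀ hν0⟩
  obtain ⟨s₁, s₂⟩ := sum_param_line e₁ e₂ e₃ hm hl
  rw [hy₁', hy₂', hy₃'] at s₁ s₂
  -- Divided by `ν y`, the line `y = ℓ x + ν` reads `w = l t + m` with `l = -ℓ/ν` and `m = 1/ν`.
  have hmw {x y : K} (hy : y ≠ 0) (h : ℓ * x + ν = y) : y⁻¹ = l * (x / y) + m := by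
    rw [hl] at h
    field_simp
    linear_combination m * h - (1 - l * x) * hm
  have hww {x y : K} (hE : W.toAffine.Equation x y) (hx : 1 < v x) (ht : v (x / y) ≤ τ) :
      v y⁻¹ ≤ τ ^ 2 := by
    obtain ⟨-, ht1, hw⟩ := val_div_of_one_lt hW hE hx
    rw [hw]
    exact (pow_le_pow_right_of_le_one' ht1.le (by norm_num : 2 ≤ 3)).trans
      (pow_le_pow_left₀ zero_le ht 2)
  have hlt {t : K} (ht : v t ≤ τ) : v (l * t) ≤ τ ^ 2 := by
    rw [mul_comm]
    exact val_mul_le (ht.trans hτ1.le) hvl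
  have hvm : v m ≤ τ ^ 2 := by
    rw [show m = y₁⁻¹ - l * (x₁ / y₁) by rw [hmw hy₁ hy₁']; ring]
    exact val_sub_le (hww h₁.1 hx₁ hτ₁) (hlt hτ₁)
  have hl1 : v l ≤ 1 := hvl.trans (hττ.trans hτ1.le)
  have hB : v (1 + (W.a₂ * l + W.a₄ * l ^ 2 + W.a₆ * l ^ 3)) = 1 := by
    refine val_one_add_of_lt (lt_of_le_of_lt ?_ (hττ.trans_lt hτ1))
    refine val_add_le (val_add_le (val_mul_le hW.a₂ hvl) (val_mul_le hW.a₄ ?_))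
      (val_mul_le hW.a₆ ?_)
    · rw [sq]; exact val_mul_le hl1 hvl
    · rw [pow_succ]; exact val_mul_le (val_pow_le_one hl1 2) hvl
  rw [← add_assoc, ← add_assoc] at hB
  set B := 1 + W.a₂ * l + W.a₄ * l ^ 2 + W.a₆ * l ^ 3
  have hB0 : B ≠ 0 := by
    rw [← v.ne_zero_iff, hB]
    exact one_ne_zero
  have hy₃0 : y₃ ≠ 0 := right_ne_zero_of_mul (s₁.trans_ne (mul_ne_zero (pow_ne_zero 3 hν0) hB0))
  have hS : v (W.a₁ * l + W.a₃ * l ^ 2 - W.a₂ * m - 2 * W.a₄ * (l * m) -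
      3 * W.a₆ * (l ^ 2 * m)) ≤ τ ^ 2 := by
    refine val_sub_le (val_sub_le (val_sub_le (val_add_le (val_mul_le hW.a₁ hvl)
      (val_mul_le hW.a₃ ?_)) (val_mul_le hW.a₂ hvm)) (val_mul_le (val_mul_le_one
        (val_ofNat_le_one 2) hW.a₄) (val_mul_le hl1 hvm))) (val_mul_le (val_mul_le_one
        (val_ofNat_le_one 3) hW.a₆) (val_mul_le (val_pow_le_one hl1 2) hvm))
    rw [sq]; exact val_mul_le hl1 hvl
  set S := W.a₁ * l + W.a₃ * l ^ 2 - W.a₂ * m - 2 * W.a₄ * (l * m) - 3 * W.a₆ * (l ^ 2 * m)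
  -- The parameters of the three collinear points add up to `S/B`: `B` is a unit, and every term of
  -- `S` contains `l` or `m`, both of size at most `τ²`.
  have hsum : x₁ / y₁ + x₂ / y₂ + x₃ / y₃ = S / B := by
    rw [eq_div_iff hB0]
    refine mul_right_cancel₀ (pow_ne_zero 3 hν0) ?_
    rw [mul_assoc, mul_comm B, ← s₁, mul_comm S, ← s₂]
    field_simp
  have hvsum : v (x₁ / y₁ + x₂ / y₂ + x₃ / y₃) ≤ τ ^ 2 := by
    rw [hsum, map_div₀, hB, div_one]
    exact hS
  have hτ₃ : v (x₃ / y₃) ≤ τ := by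
    rw [show x₃ / y₃ = (x₁ / y₁ + x₂ / y₂ + x₃ / y₃) - x₁ / y₁ - x₂ / y₂ by ring]
    exact val_sub_le (val_sub_le (hvsum.trans hττ) hτ₁) hτ₂
  -- If `x₃` were integral, so would be `y₃`; but `1/y₃ = l t₃ + m` has valuation less than `1`.
  have hv₃ : 1 < v x₃ := by
    by_contra! hle
    have h1 := val_y_le_one hW h₃ hle
    have h2 : v y₃⁻¹ ≤ τ ^ 2 := by
      rw [hmw hy₃0 hy₃']
      exact val_add_le (hlt hτ₃) hvm
    rw [map_inv₀] at h2
    have h3 : 1 ≤ (v y₃)⁻¹ := (one_le_inv₀ (zero_lt_iff.2 ((v.ne_zero_iff).2 hy₃0))).2 h1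
    exact (h3.trans_lt (h2.trans_lt (hττ.trans_lt hτ1))).false
  -- The sum is the negative of the third collinear point; the sign costs another second-order
  -- error.
  obtain ⟨n₁, n₂⟩ := val_neg_param_add hW h₃ hv₃ hτ1 hτ₃
  refine ⟨⟨hv₃, n₁⟩, ?_⟩
  change v (x₃ / W.toAffine.negY x₃ y₃ - x₁ / y₁ - x₂ / y₂) ≤ τ ^ 2
  rw [show x₃ / W.toAffine.negY x₃ y₃ - x₁ / y₁ - x₂ / y₂ = (x₃ / W.toAffine.negY x₃ y₃ + x₃ / y₃) -
    (x₁ / y₁ + x₂ / y₂ + x₃ / y₃) by ring]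
  exact val_sub_le n₂ hvsum

theorem NearOrigin.nsmul [DecidableEq K] {W : WeierstrassCurve K} (hW : IsIntegralAt v W) {τ : Γ₀}
    (hτ1 : τ < 1) {P : W.toAffine.Point} (hP : NearOrigin v τ P) (n : ℕ) :
    NearOrigin v τ (n • P) ∧ v (originParam (n • P) - n * originParam P) ≤ τ ^ 2 := by
  induction n with
  | zero =>
    rw [zero_nsmul]
    exact ⟨trivial, by simp [originParam]⟩
  | succ n ih =>
    obtain ⟨h1, h2⟩ := NearOrigin.add hW hτ1 ih.1 hP
    rw [succ_nsmul]
    refine ⟨h1, ?_⟩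
    have := val_add_le h2 ih.2
    refine le_trans (le_of_eq ?_) this
    congr 1
    push_cast
    ring

/-- There is no nonzero `N`-torsion in the kernel of reduction when `N` is a unit. -/
theorem nsmul_ne_zero_of_one_lt [DecidableEq K] {W : WeierstrassCurve K} (hW : IsIntegralAt v W)
    {N : ℕ} (hN : v (N : K) = 1) {x y : K} (h : W.toAffine.Nonsingular x y) (hx : 1 < v x) :
    N • (.some x y h : W.toAffine.Point) ≠ 0 := by
  intro h0
  obtain ⟨hy0, ht1, -⟩ := val_div_of_one_lt hW h.1 hx
  -- Take `τ = v (x/y)` itself: `N P = 0` would give `τ = v (N x/y) ≤ τ²`, impossible for `0 < τ <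
  -- 1`.
  obtain ⟨-, h2⟩ := NearOrigin.nsmul hW ht1 (P := .some x y h) ⟨hx, le_rfl⟩ N
  rw [h0] at h2
  simp only [originParam, zero_sub, v.map_neg, map_mul, hN, one_mul] at h2
  have hx0 : x / y ≠ 0 := by
    refine div_ne_zero ?_ hy0
    rintro rfl
    rw [map_zero] at hx
    exact hx.not_ge zero_le
  have hpos : 0 < v (x / y) := zero_lt_iff.2 ((v.ne_zero_iff).2 hx0)
  refine h2.not_gt ?_
  rw [sq]
  exact mul_lt_of_lt_one_left hpos ht1

/-- Two `N`-torsion points with the same reduction are equal, for a curve with good reduction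
at a valuation for which `N` is a unit. -/
theorem torsion_eq_of_val_sub_lt [DecidableEq K] {W : WeierstrassCurve K} (hW : IsIntegralAt v W)
    (hΔ : v W.Δ = 1) {N : ℕ} (hN : v (N : K) = 1) {x y x' y' : K}
    (hP : W.toAffine.Nonsingular x y) (hP' : W.toAffine.Nonsingular x' y')
    (hNP : N • (.some x y hP : W.toAffine.Point) = 0)
    (hNP' : N • (.some x' y' hP' : W.toAffine.Point) = 0)
    (hxx : v x ≤ 1 → v (x - x') < 1) (hyy : v y ≤ 1 → v (y - y') < 1) :
    (.some x y hP : W.toAffine.Point) = .some x' y' hP' := by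
  by_contra hne
  have hx : v x ≤ 1 := not_lt.1 fun h => nsmul_ne_zero_of_one_lt hW hN hP h hNP
  have hx' : v x' ≤ 1 := not_lt.1 fun h => nsmul_ne_zero_of_one_lt hW hN hP' h hNP'
  have hy := val_y_le_one hW hP.1 hx
  have hy' := val_y_le_one hW hP'.1 hx'
  obtain ⟨x₃, y₃, h₃, hx₃, heq⟩ := exists_sub_eq_some hW hΔ hP hP' hx hy hx' hy' (hxx hx) (hyy hy)
    hne
  refine nsmul_ne_zero_of_one_lt hW hN h₃ hx₃ ?_
  rw [← heq, nsmul_sub, hNP, hNP', sub_zero]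

end Reduction
end EllipticTwist

namespace EllipticTwist

open IsDedekindDomain IntermediateField

/-! ### Inertia groups in infinite Galois extensions -/

section Inertia

open scoped Pointwise

variable {F : Type*} [Field F]

theorem ringOfIntegers_smul_coe {k Ω : Type*} [Field k] [Field Ω] [Algebra k Ω] (σ : Ω ≃ₐ[k] Ω)
    (b : 𝓞 Ω) : ((σ • b : 𝓞 Ω) : Ω) = σ b :=
  rfl

theorem smulCommClass_ringOfIntegers (k Ω : Type*) [Field k] [Field Ω] [Algebra k Ω] :
    SMulCommClass (Ω ≃ₐ[k] Ω) (𝓞 k) (𝓞 Ω) := by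
  refine ⟨fun σ a b => NumberField.RingOfIntegers.ext ?_⟩
  simp only [Algebra.smul_def, ringOfIntegers_smul_coe, map_mul]
  congr 1
  exact σ.commutes a

theorem isInvariant_ringOfIntegers (k Ω : Type*) [Field k] [Field Ω] [Algebra k Ω] [IsGalois k Ω] :
    Algebra.IsInvariant (𝓞 k) (𝓞 Ω) (Ω ≃ₐ[k] Ω) := by
  refine ⟨fun b hb => ?_⟩
  have h : (b : Ω) ∈ (⊥ : IntermediateField k Ω) :=
    (InfiniteGalois.mem_bot_iff_fixed _).2 fun σ => congrArg (fun c : 𝓞 Ω => (c : Ω)) (hb σ)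
  obtain ⟨a, ha⟩ := IntermediateField.mem_bot.1 h
  have hint : IsIntegral ℤ a := by
    rw [← isIntegral_algebraMap_iff (algebraMap k Ω).injective, ha]
    exact b.2
  exact ⟨⟨a, hint⟩, NumberField.RingOfIntegers.ext ha⟩

/-- Algebraic elements have open stabilizers in the Krull topology. This is the continuity needed
for the profinite theorems on transitivity on primes and on residue automorphisms. -/
theorem continuousSMul_ringOfIntegers (k Ω : Type*) [Field k] [Field Ω] [Algebra k Ω]
    [Algebra.IsAlgebraic k Ω] [TopologicalSpace (𝓞 Ω)] [DiscreteTopology (𝓞 Ω)] :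
    ContinuousSMul (Ω ≃ₐ[k] Ω) (𝓞 Ω) := by
  rw [continuousSMul_iff_stabilizer_isOpen]
  intro b
  have h : MulAction.stabilizer (Ω ≃ₐ[k] Ω) b = MulAction.stabilizer (Ω ≃ₐ[k] Ω) (b : Ω) := by
    ext σ
    exact NumberField.RingOfIntegers.ext_iff
  rw [h]
  exact stabilizer_isOpen_of_isIntegral (b : Ω)

variable {Ω : Type*} [Field Ω] [Algebra F Ω] [IsGalois F Ω]

/-- An automorphism in the inertia group of a prime of an intermediate field lifts to the inertia
group of any prime above it. -/
theorem exists_inertia_lift (K : IntermediateField F Ω) (Q : Ideal (𝓞 Ω)) [Q.IsPrime]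
    (τ : K ≃ₐ[F] K) (hτ : τ ∈ (Q.under (𝓞 K)).inertia (K ≃ₐ[F] K)) :
    ∃ σ : Ω ≃ₐ[F] Ω, σ ∈ Q.inertia (Ω ≃ₐ[F] Ω) ∧ ∀ x : K, σ x = τ x := by
  let _ : TopologicalSpace (𝓞 Ω) := ⊥
  have : DiscreteTopology (𝓞 Ω) := ⟨rfl⟩
  have := smulCommClass_ringOfIntegers K Ω
  have := isInvariant_ringOfIntegers K Ω
  have := continuousSMul_ringOfIntegers K Ω
  set P := Q.under (𝓞 K) with hP
  set σ₀ := τ.liftNormal Ω with hσ₀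
  have hσ₀K (x : K) : σ₀ x = τ x := τ.liftNormal_commutes Ω x
  have hinv (a : 𝓞 K) : σ₀⁻¹ • (algebraMap (𝓞 K) (𝓞 Ω) a) = algebraMap (𝓞 K) (𝓞 Ω) (τ⁻¹ • a) := by
    refine NumberField.RingOfIntegers.ext ?_
    rw [ringOfIntegers_smul_coe]
    change σ₀⁻¹ ((a : K) : Ω) = ((τ⁻¹ (a : K) : K) : Ω)
    apply σ₀.injective
    rw [hσ₀K]
    change (σ₀ * σ₀⁻¹) _ = (((τ * τ⁻¹) (a : K) : K) : Ω)
    rw [mul_inv_cancel, mul_inv_cancel]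
    rfl
  -- As `τ` is trivial modulo `P`, both `σ₀ Q` and `Q` lie over `P`; an element of `Gal(Ω/K)` then
  -- corrects `σ₀` to `σ₁` stabilizing `Q`.
  have hunder : (σ₀ • Q).under (𝓞 K) = Q.under (𝓞 K) := by
    ext a
    rw [Ideal.mem_comap, Ideal.mem_pointwise_smul_iff_inv_smul_mem, hinv, ← Ideal.mem_comap,
      ← Ideal.under_def, ← hP]
    have h1 : τ⁻¹ • a - a ∈ P := (inv_mem hτ) a
    exact ⟨fun h => by simpa using P.sub_mem h h1, fun h => by simpa using P.add_mem h1 h⟩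
  obtain ⟨h, hh⟩ := Algebra.IsInvariant.exists_smul_of_under_eq_of_profinite
    (G := Ω ≃ₐ[K] Ω) (A := 𝓞 K) (σ₀ • Q) Q hunder
  set σ₁ : Ω ≃ₐ[F] Ω := h.restrictScalars F * σ₀ with hσ₁
  have hσ₁Q : σ₁ • Q = Q := by
    rw [hσ₁, mul_smul]
    exact hh.symm
  have hσ₁K (x : K) : σ₁ x = τ x := by
    change h (σ₀ x) = τ x
    rw [hσ₀K]
    exact h.commutes (τ x)
  let e₀ : (𝓞 Ω ⧸ Q) ≃+* (𝓞 Ω ⧸ Q) :=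
    Ideal.quotientEquiv Q Q (MulSemiringAction.toRingEquiv (Ω ≃ₐ[F] Ω) (𝓞 Ω) σ₁) hσ₁Q.symm
  have : Q.LiesOver P := ⟨rfl⟩
  let e : (𝓞 Ω ⧸ Q) ≃ₐ[𝓞 K ⧸ P] (𝓞 Ω ⧸ Q) := AlgEquiv.ofRingEquiv (f := e₀) <| by
    intro a
    obtain ⟨a, rfl⟩ := Ideal.Quotient.mk_surjective a
    change Ideal.Quotient.mk Q (σ₁ • algebraMap (𝓞 K) (𝓞 Ω) a) =
      Ideal.Quotient.mk Q (algebraMap (𝓞 K) (𝓞 Ω) a)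
    rw [Ideal.Quotient.eq]
    have h1 : τ • a - a ∈ P := hτ a
    have h2 : σ₁ • algebraMap (𝓞 K) (𝓞 Ω) a = algebraMap (𝓞 K) (𝓞 Ω) (τ • a) :=
      NumberField.RingOfIntegers.ext (hσ₁K (a : K))
    rw [h2, ← map_sub]
    exact h1
  -- The residue automorphism induced by `σ₁` is also induced by some `g` fixing `K`, so `g⁻¹ σ₁` is
  -- inertial and still restricts to `τ`.
  obtain ⟨g, hg⟩ := Ideal.Quotient.stabilizerHom_surjective_of_profinite
    (G := Ω ≃ₐ[K] Ω) P Q e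
  have hgb (b : 𝓞 Ω) : σ₁ • b - g.1 • b ∈ Q := by
    rw [← Ideal.Quotient.eq]
    exact (DFunLike.congr_fun hg (Ideal.Quotient.mk Q b)).symm
  refine ⟨(g.1.restrictScalars F)⁻¹ * σ₁, fun b => ?_, fun x => ?_⟩
  · have h1 : (g.1.restrictScalars F)⁻¹ • (σ₁ • b - g.1 • b) ∈ Q := by
      have : (g.1.restrictScalars F) • Q = Q := g.2
      rw [← Ideal.mem_pointwise_smul_iff_inv_smul_mem, this]
      exact hgb b
    rw [smul_sub] at h1
    have h2 : (g.1.restrictScalars F)⁻¹ • g.1 • b = b := inv_smul_smul (g.1.restrictScalars F) b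
    rw [h2, ← mul_smul] at h1
    exact h1
  · change (g.1.restrictScalars F)⁻¹ (σ₁ x) = τ x
    rw [hσ₁K]
    apply (g.1.restrictScalars F).injective
    change (g.1.restrictScalars F * (g.1.restrictScalars F)⁻¹) _ = _
    rw [mul_inv_cancel]
    exact (g.1.commutes (τ x)).symm

/-- The inertia group of a prime of `K` has order equal to the ramification index, so ramification
yields a nontrivial inertia element to lift. -/
theorem exists_inertia_of_ramifiesIn [NumberField F] (K : IntermediateField F Ω)
    [FiniteDimensional F K] [IsGalois F K] (v : HeightOneSpectrum (𝓞 F)) (h : RamifiesIn v K) :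
    ∃ Q : Ideal (𝓞 Ω), Q.IsPrime ∧ Q.under (𝓞 F) = v.asIdeal ∧
      ∃ σ ∈ Q.inertia (Ω ≃ₐ[F] Ω), ∃ x ∈ K, σ x ≠ x := by
  obtain ⟨P, hP, hPv, he⟩ := h
  have : NumberField K := NumberField.of_module_finite F K
  have hcard := Ideal.card_inertia_eq_ramificationIdxIn (G := K ≃ₐ[F] K) v.asIdeal P
  rw [Ideal.ramificationIdxIn_eq_ramificationIdx v.asIdeal P (K ≃ₐ[F] K)] at hcard
  have : Nontrivial (P.inertia (K ≃ₐ[F] K)) := by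
    rw [← Finite.one_lt_card_iff_nontrivial, hcard]
    exact he
  obtain ⟨⟨τ, hτ⟩, hτ1⟩ := exists_ne (1 : P.inertia (K ≃ₐ[F] K))
  have : Algebra.IsIntegral (𝓞 K) (𝓞 Ω) := Algebra.IsIntegral.tower_top ℤ
  obtain ⟨⟨Q, hQ, hQP⟩⟩ := P.nonempty_primesOver (S := 𝓞 Ω)
  have hQP' : P = Q.under (𝓞 K) := hQP.over
  subst hQP'
  obtain ⟨σ, hσ, hστ⟩ := exists_inertia_lift K Q τ hτ
  refine ⟨Q, hQ, ?_, σ, hσ, ?_⟩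
  · rw [hPv.over, Ideal.under_under]
  · by_contra! hall
    refine hτ1 (Subtype.ext (AlgEquiv.ext fun x => Subtype.ext ?_))
    exact (hστ x).symm.trans (hall x x.2)

/-- Restriction to `K` sends inertia at `Q` to inertia at the prime below; a nontrivial image forces
ramification index above `1`. -/
theorem ramifiesIn_of_inertia {Ω : Type*} [Field Ω] [Algebra F Ω] [NumberField F]
    (K : IntermediateField F Ω)
    [FiniteDimensional F K] [IsGalois F K] (v : HeightOneSpectrum (𝓞 F)) (Q : Ideal (𝓞 Ω))
    [Q.IsPrime] (hQ : Q.under (𝓞 F) = v.asIdeal) (σ : Ω ≃ₐ[F] Ω) (hσ : σ ∈ Q.inertia (Ω ≃ₐ[F] Ω))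
    {x : Ω} (hx : x ∈ K) (hσx : σ x ≠ x) : RamifiesIn v K := by
  have : NumberField K := NumberField.of_module_finite F K
  have hPv : (Q.under (𝓞 K)).LiesOver v.asIdeal := ⟨by rw [Ideal.under_under, hQ]⟩
  refine ⟨Q.under (𝓞 K), inferInstance, hPv, ?_⟩
  have hcard := Ideal.card_inertia_eq_ramificationIdxIn (G := K ≃ₐ[F] K) v.asIdeal
    (Q.under (𝓞 K))
  rw [Ideal.ramificationIdxIn_eq_ramificationIdx v.asIdeal (Q.under (𝓞 K)) (K ≃ₐ[F] K)] at hcard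
  rw [← hcard, Finite.one_lt_card_iff_nontrivial]
  have hres (y : K) : ((σ.restrictNormal K y : K) : Ω) = σ y := σ.restrictNormal_commutes K y
  refine ⟨⟨σ.restrictNormal K, fun a => ?_⟩, 1, fun h1 => hσx ?_⟩
  · rw [Submodule.mem_toAddSubgroup, Ideal.mem_comap, map_sub]
    have h2 : σ • algebraMap (𝓞 K) (𝓞 Ω) a = algebraMap (𝓞 K) (𝓞 Ω) (σ.restrictNormal K • a) :=
      NumberField.RingOfIntegers.ext (hres a).symm
    rw [← h2]
    exact hσ _
  · have := hres ⟨x, hx⟩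
    rw [show σ.restrictNormal K = 1 from congrArg Subtype.val h1] at this
    exact this.symm

end Inertia
end EllipticTwist

namespace EllipticTwist

open IsDedekindDomain IntermediateField

/-! ### The valuation at a prime of an algebraic extension -/

section LocalRing

variable {F : Type*} [Field F] [NumberField F] {Ω : Type*} [Field Ω] [Algebra F Ω]
  [Algebra.IsAlgebraic F Ω]

/-- The localization of the integers of an algebraic extension of a number field at a nonzero prime
is a valuation ring. -/
def primeValuationSubring (v : HeightOneSpectrum (𝓞 F)) (Q : Ideal (𝓞 Ω)) [hQ : Q.IsPrime]
    (hv : Q.under (𝓞 F) = v.asIdeal) : ValuationSubring Ω where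
  carrier := {z | ∃ a b : 𝓞 Ω, b ∉ Q ∧ z * algebraMap (𝓞 Ω) Ω b = algebraMap (𝓞 Ω) Ω a}
  mul_mem' := by
    rintro z z' ⟨a, b, hb, h⟩ ⟨a', b', hb', h'⟩
    refine ⟨a * a', b * b', hQ.mul_notMem hb hb', ?_⟩
    rw [map_mul, map_mul, ← h, ← h']
    ring
  one_mem' := ⟨1, 1, hQ.one_notMem, by simp⟩
  add_mem' := by
    rintro z z' ⟨a, b, hb, h⟩ ⟨a', b', hb', h'⟩
    refine ⟨a * b' + a' * b, b * b', hQ.mul_notMem hb hb', ?_⟩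
    rw [map_mul, map_add, map_mul, map_mul, ← h, ← h']
    ring
  zero_mem' := ⟨0, 1, hQ.one_notMem, by simp⟩
  neg_mem' := by
    rintro z ⟨a, b, hb, h⟩
    refine ⟨-a, b, hb, ?_⟩
    rw [map_neg, ← h, neg_mul]
  mem_or_inv_mem' := by
    intro z
    have hz : IsIntegral F z := Algebra.IsIntegral.isIntegral z
    have := adjoin.finiteDimensional hz
    have : NumberField F⟮z⟯ := NumberField.of_module_finite F F⟮z⟯
    -- Only the number field `F(z)` matters for `z`: there `Q` cuts out a nonzero prime, whose
    -- localization is a discrete valuation ring.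
    let w : HeightOneSpectrum (𝓞 F⟮z⟯) := ⟨Q.under _, inferInstance, fun h => v.ne_bot <| by
      rw [← hv, ← Ideal.under_under (B := 𝓞 F⟮z⟯), h]
      exact Ideal.under_bot _ _⟩
    by_cases hz0 : z = 0
    · exact Or.inl ⟨0, 1, hQ.one_notMem, by simp [hz0]⟩
    obtain ⟨n, ⟨d, hd⟩, h⟩ := w.exists_primeCompl_mul_eq_or_mul_eq (AdjoinSimple.gen F z)
    have hd' : algebraMap _ (𝓞 Ω) d ∉ Q := hd
    rcases h with h | h
    · exact Or.inl ⟨algebraMap _ _ n, algebraMap _ _ d, hd', congrArg (algebraMap F⟮z⟯ Ω) h⟩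
    · refine Or.inr ⟨algebraMap _ _ n, algebraMap _ _ d, hd', ?_⟩
      have h' : z * algebraMap (𝓞 Ω) Ω (algebraMap _ (𝓞 Ω) n) = algebraMap (𝓞 Ω) Ω (algebraMap _ (𝓞 Ω) d) :=
        congrArg (algebraMap F⟮z⟯ Ω) h
      rw [← h', inv_mul_cancel_left₀ hz0]

variable (v : HeightOneSpectrum (𝓞 F)) (Q : Ideal (𝓞 Ω)) [hQ : Q.IsPrime]
    (hv : Q.under (𝓞 F) = v.asIdeal)

theorem valuation_primeValuationSubring_lt_one {z : Ω} {a b : 𝓞 Ω} (ha : a ∈ Q) (hb : b ∉ Q)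
    (h : z * algebraMap (𝓞 Ω) Ω b = algebraMap (𝓞 Ω) Ω a) : (primeValuationSubring v Q hv).valuation z < 1 := by
  by_cases hz0 : z = 0
  · simp [hz0]
  by_contra! hle
  have hinv : (primeValuationSubring v Q hv).valuation z⁻¹ ≤ 1 := by
    rw [map_inv₀]
    exact inv_le_one_of_one_le₀ hle
  rw [ValuationSubring.valuation_le_one_iff] at hinv
  obtain ⟨c, d, hd, h'⟩ := hinv
  have : b * d = c * a := by
    refine FaithfulSMul.algebraMap_injective (𝓞 Ω) Ω ?_
    rw [map_mul, map_mul, ← h, ← h']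
    field_simp
  exact hQ.mul_notMem hb hd (this ▸ Q.mul_mem_left c ha)

/-- For `z = a/b` with `b ∉ Q`, the numerator `a σ(b) - σ(a) b` of `z - σ z` lies in `Q`, because
`σ` is the identity modulo `Q`. -/
theorem valuation_sub_lt_one_of_inertia {σ : Ω ≃ₐ[F] Ω} (hσ : σ ∈ Q.inertia (Ω ≃ₐ[F] Ω)) {z : Ω}
    (hz : (primeValuationSubring v Q hv).valuation z ≤ 1) :
    (primeValuationSubring v Q hv).valuation (z - σ z) < 1 := by
  rw [ValuationSubring.valuation_le_one_iff] at hz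
  obtain ⟨a, b, hb, h⟩ := hz
  have hσb : σ • b ∉ Q := fun h' => hb (by simpa using Q.sub_mem h' (hσ b))
  refine valuation_primeValuationSubring_lt_one v Q hv (a := a * (σ • b) - (σ • a) * b)
    (b := b * σ • b) ?_ (hQ.mul_notMem hb hσb) ?_
  · have : a * (σ • b) - (σ • a) * b = a * (σ • b - b) - (σ • a - a) * b := by ring
    rw [this]
    exact Q.sub_mem (Q.mul_mem_left _ (hσ b)) (Q.mul_mem_right _ (hσ a))
  · have h' : σ z * algebraMap (𝓞 Ω) Ω (σ • b) = algebraMap (𝓞 Ω) Ω (σ • a) := by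
      change σ z * σ (algebraMap (𝓞 Ω) Ω b) = σ (algebraMap (𝓞 Ω) Ω a)
      rw [← map_mul, h]
    rw [map_mul, map_sub, map_mul, map_mul, ← h, ← h']
    ring

theorem valuation_algebraMap_le_one {x : F} (hx : v.valuation F x ≤ 1) :
    (primeValuationSubring v Q hv).valuation (algebraMap F Ω x) ≤ 1 := by
  obtain ⟨n, ⟨d, hd⟩, h⟩ := v.exists_primeCompl_mul_eq_of_integer x hx
  rw [ValuationSubring.valuation_le_one_iff]
  refine ⟨algebraMap _ _ n, algebraMap _ _ d, fun h' => hd ?_, ?_⟩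
  · rw [← hv]
    exact h'
  · rw [← IsScalarTower.algebraMap_apply, ← IsScalarTower.algebraMap_apply,
      IsScalarTower.algebraMap_apply (𝓞 F) F Ω, IsScalarTower.algebraMap_apply (𝓞 F) F Ω, ← map_mul,
      h]

theorem valuation_algebraMap_eq_one {x : F} (hx : v.valuation F x = 1) :
    (primeValuationSubring v Q hv).valuation (algebraMap F Ω x) = 1 := by
  refine le_antisymm (valuation_algebraMap_le_one v Q hv hx.le) ?_
  have h := valuation_algebraMap_le_one v Q hv (x := x⁻¹) (by rw [map_inv₀, hx, inv_one])
  rw [map_inv₀, map_inv₀] at h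
  refine (inv_le_one₀ (zero_lt_iff.2 fun h0 => ?_)).1 h
  rw [Valuation.zero_iff, map_eq_zero] at h0
  rw [h0, map_zero] at hx
  exact zero_ne_one hx

/-- Inertia acts trivially on the `N`-torsion of an elliptic curve at a prime of good reduction not
dividing `N`. -/
theorem inertia_acts_trivially (hv : Q.under (𝓞 F) = v.asIdeal) {W : WeierstrassCurve F} (hW : IsIntegralAt (v.valuation F) W)
    (hΔ : v.valuation F W.Δ = 1) {N : ℕ} (hN : (N : 𝓞 F) ∉ v.asIdeal) {σ : Ω ≃ₐ[F] Ω}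
    (hσ : σ ∈ Q.inertia (Ω ≃ₐ[F] Ω)) :
    ∀ P ∈ torsion W Ω N, galPoint W Ω σ P = P := by
  classical
  set A := primeValuationSubring v Q hv
  have hW' : IsIntegralAt A.valuation (W.baseChange Ω) :=
    ⟨valuation_algebraMap_le_one v Q hv hW.a₁, valuation_algebraMap_le_one v Q hv hW.a₂,
      valuation_algebraMap_le_one v Q hv hW.a₃, valuation_algebraMap_le_one v Q hv hW.a₄,
      valuation_algebraMap_le_one v Q hv hW.a₆⟩
  have hΔ' : A.valuation (W.baseChange Ω).Δ = 1 := by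
    rw [WeierstrassCurve.baseChange, WeierstrassCurve.map_Δ]
    exact valuation_algebraMap_eq_one v Q hv hΔ
  have hN' : A.valuation (N : Ω) = 1 := by
    rw [← map_natCast (algebraMap F Ω)]
    apply valuation_algebraMap_eq_one v Q hv
    rw [← map_natCast (algebraMap (𝓞 F) F), HeightOneSpectrum.valuation_eq_one_iff_notMem]
    exact hN
  rintro (_ | ⟨x, y, h⟩) hP
  · rfl
  have hP' := galPoint_mem W Ω N σ hP
  rw [AddSubgroup.torsionBy.nsmul_iff] at hP hP'
  refine (torsion_eq_of_val_sub_lt hW' hΔ' hN' _ _ ?_ ?_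
    (fun hx => valuation_sub_lt_one_of_inertia v Q hv hσ hx)
    (fun hy => valuation_sub_lt_one_of_inertia v Q hv hσ hy)).symm
  · convert hP
  · convert hP'
    rfl

end LocalRing

/-! ### Primes away from the conductor have good reduction -/

section Conductor

open WeierstrassCurve

variable {F : Type*} [Field F] [NumberField F] (E : WeierstrassCurve F)

/-- Reduction types use the valuation of the maximal ideal of `localRing v`, the estimates above use
`v.valuation F`; on integral elements both detect the maximal ideal. -/
theorem valuation_maximalIdeal_localRing_lt_one_iff (v : HeightOneSpectrum (𝓞 F)) {x : F}
    (hx : v.valuation F x ≤ 1) :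
    (IsDiscreteValuationRing.maximalIdeal (localRing v)).valuation F x < 1 ↔
      v.valuation F x < 1 := by
  have h := HeightOneSpectrum.valuation_lt_one_iff_mem (K := F)
    (IsDiscreteValuationRing.maximalIdeal (localRing v)) ⟨x, hx⟩
  refine h.trans ?_
  change (⟨x, hx⟩ : localRing v) ∈ IsLocalRing.maximalIdeal (localRing v) ↔ _
  rw [ValuationSubring.valuation_lt_one_iff]
  exact (v.valuation F).isEquiv_valuation_valuationSubring.lt_one_iff_lt_one.symm

theorem valuation_maximalIdeal_localRing_eq_one_iff (v : HeightOneSpectrum (𝓞 F)) {x : F}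
    (hx : v.valuation F x ≤ 1) :
    (IsDiscreteValuationRing.maximalIdeal (localRing v)).valuation F x = 1 ↔
      v.valuation F x = 1 := by
  have h := valuation_maximalIdeal_localRing_lt_one_iff v hx
  have h' : (IsDiscreteValuationRing.maximalIdeal (localRing v)).valuation F x ≤ 1 :=
    HeightOneSpectrum.valuation_le_one (K := F)
      (IsDiscreteValuationRing.maximalIdeal (localRing v)) ⟨x, hx⟩
  rw [← not_iff_not, ← ne_eq, ← ne_eq, ← h'.lt_iff_ne, ← hx.lt_iff_ne, h]

theorem isIntegralAt_of_isIntegral (v : HeightOneSpectrum (𝓞 F)) (W : WeierstrassCurve F)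
    [IsIntegral (localRing v) W] : IsIntegralAt (v.valuation F) W := by
  obtain ⟨W₀, rfl⟩ := IsIntegral.integral (R := localRing v) (W := W)
  exact ⟨W₀.a₁.2, W₀.a₂.2, W₀.a₃.2, W₀.a₄.2, W₀.a₆.2⟩

theorem isIntegral_of_isIntegralAt (v : HeightOneSpectrum (𝓞 F)) (W : WeierstrassCurve F)
    (h : IsIntegralAt (v.valuation F) W) : IsIntegral (localRing v) W :=
  isIntegral_of_exists_lift _ ⟨⟨_, h.a₁⟩, rfl⟩ ⟨⟨_, h.a₂⟩, rfl⟩ ⟨⟨_, h.a₃⟩, rfl⟩ ⟨⟨_, h.a₄⟩, rfl⟩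
    ⟨⟨_, h.a₆⟩, rfl⟩

theorem valuation_Δ_le_one (v : HeightOneSpectrum (𝓞 F)) (W : WeierstrassCurve F)
    [IsIntegral (localRing v) W] : v.valuation F W.Δ ≤ 1 := by
  obtain ⟨r, hr⟩ := Δ_integral_of_isIntegral (localRing v) W
  rw [← hr]
  exact r.2

theorem conductorExponent_eq_zero_iff (v : HeightOneSpectrum (𝓞 F)) :
    conductorExponent E v = 0 ↔ (E.minimal (localRing v)).HasGoodReduction (localRing v) := by
  rw [conductorExponent]
  split_ifs with h1 h2
  · simp [h1]
  · simp [h1]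
  · simp [h1]

/-- At a prime of good reduction there is an integral model with unit discriminant. -/
theorem exists_good_model (v : HeightOneSpectrum (𝓞 F)) (h : conductorExponent E v = 0) :
    ∃ C : VariableChange F, IsIntegralAt (v.valuation F) (C • E) ∧
      v.valuation F (C • E).Δ = 1 := by
  rw [conductorExponent_eq_zero_iff] at h
  refine ⟨(E.exists_isMinimal (localRing v)).choose, ?_, ?_⟩
  · exact isIntegralAt_of_isIntegral v (E.minimal (localRing v))
  · exact (valuation_maximalIdeal_localRing_eq_one_iff v
      (valuation_Δ_le_one v (E.minimal (localRing v)))).1 h.goodReduction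

/-- A minimal model maximizes the multiplicative valuation of `Δ` among integral models, and `E`
already attains the upper bound `1`. -/
theorem conductorExponent_eq_zero_of_isIntegralAt (v : HeightOneSpectrum (𝓞 F))
    (h : IsIntegralAt (v.valuation F) E) (hΔ : v.valuation F E.Δ = 1) :
    conductorExponent E v = 0 := by
  rw [conductorExponent_eq_zero_iff]
  have hE := isIntegral_of_isIntegralAt v E h
  set W := E.minimal (localRing v) with hW
  have hmin : IsMinimal (localRing v) W := inferInstance
  refine { hmin with goodReduction := ?_ }
  obtain ⟨C, hC⟩ : ∃ C : VariableChange F, C • W = E :=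
    ⟨(E.exists_isMinimal (localRing v)).choose⁻¹, inv_smul_smul _ _⟩
  have h1 := hmin.val_Δ_maximal.2 (j := C) (by change IsIntegral _ (C • W); rw [hC]; exact hE)
  simp only [one_smul, hC] at h1
  have e1 : (valuation_Δ_aux (localRing v) E : WithZero (Multiplicative ℤ)) = 1 := by
    rw [valuation_Δ_aux_eq_of_isIntegral]
    exact (valuation_maximalIdeal_localRing_eq_one_iff v hΔ.le).2 hΔ
  have h2 := h1 (by
    rw [← Subtype.coe_le_coe, e1]
    exact (valuation_Δ_aux (localRing v) W).2)
  rw [← Subtype.coe_le_coe, e1, valuation_Δ_aux_eq_of_isIntegral] at h2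
  exact le_antisymm ((valuation_Δ_aux_eq_of_isIntegral (localRing v) W) ▸
    (valuation_Δ_aux (localRing v) W).2) h2

theorem finite_one_lt_valuation (x : F) :
    {v : HeightOneSpectrum (𝓞 F) | 1 < v.valuation F x}.Finite :=
  HeightOneSpectrum.Support.finite (𝓞 F) x

theorem finite_valuation_ne_one {x : F} (hx : x ≠ 0) :
    {v : HeightOneSpectrum (𝓞 F) | v.valuation F x ≠ 1}.Finite := by
  refine ((finite_one_lt_valuation x).union (finite_one_lt_valuation x⁻¹)).subset fun v hv => ?_
  rcases lt_or_gt_of_ne hv with h | h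
  · refine Or.inr ?_
    have h0 : v.valuation F x ≠ 0 := (Valuation.ne_zero_iff _).2 hx
    rw [Set.mem_ofPred_eq, map_inv₀]
    exact (one_lt_inv₀ (zero_lt_iff.2 h0)).2 h
  · exact Or.inl h

/-- At all but finitely many primes the given equation is integral with unit discriminant.
Finiteness matters because a `∏ᶠ` of infinite support is `1` by default. -/
theorem finite_conductorExponent_ne_zero [E.IsElliptic] :
    {v : HeightOneSpectrum (𝓞 F) | conductorExponent E v ≠ 0}.Finite := by
  have hΔ : E.Δ ≠ 0 := E.isUnit_Δ.ne_zero
  refine ((finite_one_lt_valuation E.a₁).union ((finite_one_lt_valuation E.a₂).union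
    ((finite_one_lt_valuation E.a₃).union ((finite_one_lt_valuation E.a₄).union
    ((finite_one_lt_valuation E.a₆).union (finite_valuation_ne_one hΔ)))))).subset ?_
  intro v hv
  by_contra hcon
  simp only [Set.mem_union, Set.mem_ofPred_eq, not_or, not_lt, not_not] at hcon
  obtain ⟨h1, h2, h3, h4, h6, hd⟩ := hcon
  exact hv (conductorExponent_eq_zero_of_isIntegralAt E v ⟨h1, h2, h3, h4, h6⟩ hd)

theorem hasFiniteMulSupport_conductor [E.IsElliptic] : Function.HasFiniteMulSupport
    fun v : HeightOneSpectrum (𝓞 F) => v.asIdeal ^ conductorExponent E v := by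
  refine (finite_conductorExponent_ne_zero E).subset fun v hv h0 => hv ?_
  simp [h0]

theorem dvd_conductor [E.IsElliptic] (v : HeightOneSpectrum (𝓞 F))
    (h : conductorExponent E v ≠ 0) : v.asIdeal ∣ conductor E :=
  (dvd_pow_self v.asIdeal h).trans (finprod_mem_dvd v (hasFiniteMulSupport_conductor E))

/-- Inertia at a prime dividing neither `N` nor the conductor acts trivially on `E[N]`. -/
theorem inertia_acts_trivially_of_not_dvd [E.IsElliptic] {N : ℕ} (v : HeightOneSpectrum (𝓞 F))
    (hN : ¬ v.asIdeal ∣ Ideal.span {(N : 𝓞 F)}) (hE : ¬ v.asIdeal ∣ conductor E)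
    {Ω : Type*} [Field Ω] [Algebra F Ω] [Algebra.IsAlgebraic F Ω] (Q : Ideal (𝓞 Ω))
    [Q.IsPrime] (hQ : Q.under (𝓞 F) = v.asIdeal) {σ : Ω ≃ₐ[F] Ω}
    (hσ : σ ∈ Q.inertia (Ω ≃ₐ[F] Ω)) : ∀ P ∈ torsion E Ω N, galPoint E Ω σ P = P := by
  obtain ⟨C, hC, hΔ⟩ := exists_good_model E v (not_not.1 fun h => hE (dvd_conductor E v h))
  refine galPoint_eq_self_of_variableChange C⁻¹ (inv_smul_smul C E).symm Ω N σ ?_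
  refine inertia_acts_trivially v Q hQ hC hΔ (fun h => hN ?_) hσ
  rwa [Ideal.dvd_span_singleton]

end Conductor

/-! ### Ramification of `F(√α)` -/

section Ramification

variable {F : Type*} [Field F] [NumberField F] (E : WeierstrassCurve F)

theorem sqrt_apply_eq_or_neg {F Ω : Type*} [Field F] [Field Ω] [Algebra F Ω] {α : F} {β : Ω}
    (hβ : β ^ 2 = algebraMap F Ω α) (σ : Ω ≃ₐ[F] Ω) : σ β = β ∨ σ β = -β := by
  rw [← sq_eq_sq_iff_eq_or_eq_neg, ← map_pow, hβ, AlgEquiv.commutes]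

theorem isGalois_adjoin_sqrt {F Ω : Type*} [Field F] [Field Ω] [Algebra F Ω] [IsGalois F Ω]
    {S : Set Ω} (hS : ∀ β ∈ S, ∃ α, β ^ 2 = algebraMap F Ω α) : IsGalois F (adjoin F S) := by
  have : Normal F (adjoin F S) := by
    rw [normal_iff_forall_map_le']
    intro σ
    rw [adjoin_map, adjoin_le_iff]
    rintro _ ⟨β, hβ, rfl⟩
    obtain ⟨α, hα⟩ := hS β hβ
    rcases sqrt_apply_eq_or_neg hα σ with h | h
    · change σ β ∈ adjoin F S
      rw [h]
      exact subset_adjoin F S hβ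
    · change σ β ∈ adjoin F S
      rw [h]
      exact neg_mem (subset_adjoin F S hβ)
  constructor

theorem finiteDimensional_adjoin_sqrt {F Ω : Type*} [Field F] [Field Ω] [Algebra F Ω] {α : F}
    {β : Ω} (hβ : β ^ 2 = algebraMap F Ω α) : FiniteDimensional F F⟮β⟯ := by
  refine adjoin.finiteDimensional ⟨Polynomial.X ^ 2 - Polynomial.C α,
    Polynomial.monic_X_pow_sub_C α two_ne_zero, ?_⟩
  simp [hβ]

theorem apply_ne_self_of_mem_adjoin {F Ω : Type*} [Field F] [Field Ω] [Algebra F Ω] {S : Set Ω}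
    (σ : Ω ≃ₐ[F] Ω) {x : Ω} (hx : x ∈ adjoin F S) (hσ : σ x ≠ x) : ∃ s ∈ S, σ s ≠ s := by
  by_contra! h
  exact hσ ((forall_mem_adjoin_smul_eq_self_iff F σ).2 h x hx)

/-- At any other ramified prime, some inertia element moves `√α`, hence negates it, while fixing
`E[N]`; then `-1` lies in the image for the twist. -/
theorem dvd_of_ramifiesIn_twist [E.IsElliptic] (N : ℕ) (α : Fˣ)
    (hα : TwistImageMissesNegOne E N α) (β : AlgebraicClosure F)
    (hβ : β ^ 2 = algebraMap F (AlgebraicClosure F) α) (v : HeightOneSpectrum (𝓞 F))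
    (hv : RamifiesIn v (adjoin F {β})) : v.asIdeal ∣ Ideal.span {(N : 𝓞 F)} ∨ v.asIdeal ∣ conductor E := by
  by_contra! h
  have : IsGalois F (adjoin F {β}) := isGalois_adjoin_sqrt (S := {β}) (by rintro _ rfl; exact ⟨_, hβ⟩)
  have := finiteDimensional_adjoin_sqrt hβ
  obtain ⟨Q, hQ, hQv, σ, hσ, x, hx, hσx⟩ := exists_inertia_of_ramifiesIn _ v hv
  obtain ⟨s, hs, hσβ⟩ := apply_ne_self_of_mem_adjoin σ hx hσx
  obtain rfl : s = β := hs
  have hneg := (sqrt_apply_eq_or_neg hβ σ).resolve_left hσβ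
  refine hα (twist_neg_one_mem_range E (α : F) s ?_ hβ N σ hneg
    (inertia_acts_trivially_of_not_dvd E v h.1 h.2 Q hQv hσ))
  rintro rfl
  exact hσβ (map_zero σ)

end Ramification
end EllipticTwist

namespace EllipticTwist

open IsDedekindDomain IntermediateField

/-! ### Abelian extensions of exponent two are generated by square roots -/

section ExponentTwo

/-- Simultaneous diagonalization of commuting involutions: split `w = (w + σ w)/2 + (w - σ w)/2` for
one `σ` at a time; commutativity preserves the eigenvector conditions already obtained. -/
theorem mem_closure_signEigenvectors {F K : Type*} [Field F] [Field K] [Algebra F K] [NeZero (2 : K)]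
    (hcomm : ∀ σ τ : K ≃ₐ[F] K, σ * τ = τ * σ) (hsq : ∀ σ : K ≃ₐ[F] K, σ ^ 2 = 1)
    (s : Finset (K ≃ₐ[F] K)) (x : K) :
    x ∈ AddSubgroup.closure {w : K | ∀ σ ∈ s, σ w = w ∨ σ w = -w} := by
  classical
  induction s using Finset.induction_on with
  | empty => exact AddSubgroup.subset_closure (by simp)
  | insert σ s _ ih =>
    refine (AddSubgroup.closure_le _).2 (fun w hw => ?_) ih
    have hc (τ : K ≃ₐ[F] K) : τ (σ w) = σ (τ w) := DFunLike.congr_fun (hcomm τ σ) w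
    have hs : σ (σ w) = w := by
      have h := DFunLike.congr_fun (hsq σ) w
      rwa [pow_two] at h
    have hdecomp : w = (w + σ w) / 2 + (w - σ w) / 2 := by
      field_simp
      ring
    have h2 (τ : K ≃ₐ[F] K) : τ 2 = 2 := map_ofNat τ 2
    rw [SetLike.mem_coe, hdecomp]
    refine add_mem (AddSubgroup.subset_closure ?_) (AddSubgroup.subset_closure ?_) <;>
    · intro τ hτ
      rcases Finset.mem_insert.1 hτ with rfl | hτ
      · first
        | left; rw [map_div₀, map_add, hs, h2, add_comm]
        | right; rw [map_div₀, map_sub, hs, h2]; ring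
      · rcases hw τ hτ with h | h
        · left
          simp only [map_div₀, map_add, map_sub, hc, h, h2]
        · right
          simp only [map_div₀, map_add, map_sub, hc, h, h2, map_neg]
          ring

theorem isAbelianOfExponentTwo_adjoin_sqrt {F : Type*} [Field F] [NumberField F]
    {S : Set (AlgebraicClosure F)}
    (hS : ∀ β ∈ S, ∃ α, β ^ 2 = algebraMap F (AlgebraicClosure F) α) :
    IsAbelianOfExponentTwo (adjoin F S) := by
  have hsign (σ : adjoin F S ≃ₐ[F] adjoin F S) (β : AlgebraicClosure F) (hβ : β ∈ S) :
      σ ⟨β, subset_adjoin F S hβ⟩ = ⟨β, subset_adjoin F S hβ⟩ ∨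
        σ ⟨β, subset_adjoin F S hβ⟩ = -⟨β, subset_adjoin F S hβ⟩ := by
    obtain ⟨α, hα⟩ := hS β hβ
    exact sqrt_apply_eq_or_neg (α := α) (Subtype.ext hα) σ
  have hext (σ τ : adjoin F S ≃ₐ[F] adjoin F S) (h : ∀ β (hβ : β ∈ S),
      σ ⟨β, subset_adjoin F S hβ⟩ = τ ⟨β, subset_adjoin F S hβ⟩) : σ = τ := by
    have : (σ : adjoin F S →ₐ[F] adjoin F S) = τ := by
      refine adjoin_algHom_ext F (s := S) ?_
      exact h
    exact AlgEquiv.ext fun x => DFunLike.congr_fun this x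
  refine ⟨isGalois_adjoin_sqrt hS, fun σ τ => hext _ _ fun β hβ => ?_,
    fun σ => hext _ _ fun β hβ => ?_⟩
  · rw [AlgEquiv.mul_apply, AlgEquiv.mul_apply]
    rcases hsign σ β hβ with h | h <;> rcases hsign τ β hβ with h' | h' <;> simp [h, h']
  · rw [pow_two, AlgEquiv.mul_apply, AlgEquiv.one_apply]
    rcases hsign σ β hβ with h | h <;> simp [h]

variable {F : Type*} [Field F] [NumberField F]

theorem IsAbelianOfExponentTwo.mono {L K : IntermediateField F (AlgebraicClosure F)}
    (hL : IsAbelianOfExponentTwo L) (h : K ≤ L) : IsAbelianOfExponentTwo K := by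
  have := hL.isGalois
  have : IsMulCommutative (L ≃ₐ[F] L) := ⟨⟨hL.comm⟩⟩
  have : IsAbelianGalois F L := {}
  have hK : IsAbelianGalois F K := IsAbelianGalois.of_algHom (inclusion h)
  refine ⟨inferInstance, fun σ τ => mul_comm' σ τ, fun σ => ?_⟩
  -- To see `σ² = 1` on `K`, extend `σ` to the algebraic closure and restrict to `L`, where squares
  -- are trivial.
  let σ' := σ.liftNormal (AlgebraicClosure F)
  ext x
  have h1 := congrArg (algebraMap L (AlgebraicClosure F))
    (DFunLike.congr_fun (hL.sq_eq_one (σ'.restrictNormal L)) ⟨x, h x.2⟩)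
  rw [pow_two, AlgEquiv.mul_apply, AlgEquiv.restrictNormal_commutes,
    AlgEquiv.restrictNormal_commutes] at h1
  rw [pow_two, AlgEquiv.mul_apply]
  have h2 (y : K) : σ' y = σ y := σ.liftNormal_commutes (AlgebraicClosure F) y
  rw [← h2, ← h2]
  exact h1

/-- Each `x ∈ L` is a sum of sign eigenvectors of the finite group `Gal(F(x)/F)`; the square of an
eigenvector is fixed, so lies in `F`. -/
theorem IsAbelianOfExponentTwo.le_adjoin_sqrt {L : IntermediateField F (AlgebraicClosure F)}
    (hL : IsAbelianOfExponentTwo L) :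
    L ≤ adjoin F {β | β ∈ L ∧ ∃ α, β ^ 2 = algebraMap F (AlgebraicClosure F) α} := by
  intro x hx
  have hxL : F⟮x⟯ ≤ L := adjoin_simple_le_iff.2 hx
  have hK := hL.mono hxL
  have := hK.isGalois
  have : FiniteDimensional F F⟮x⟯ := adjoin.finiteDimensional (Algebra.IsIntegral.isIntegral x)
  have := mem_closure_signEigenvectors hK.comm hK.sq_eq_one Finset.univ (AdjoinSimple.gen F x)
  have h : AdjoinSimple.gen F x ∈ (adjoin F {β | β ∈ L ∧ ∃ α, β ^ 2 =
      algebraMap F (AlgebraicClosure F) α}).toSubalgebra.toSubring.toAddSubgroup.comap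
        (algebraMap F⟮x⟯ (AlgebraicClosure F)).toAddMonoidHom := by
    refine (AddSubgroup.closure_le _).2 (fun w hw => ?_) this
    refine subset_adjoin F _ ⟨hxL w.2, ?_⟩
    have hw2 : w ^ 2 ∈ (⊥ : IntermediateField F F⟮x⟯) := by
      rw [IsGalois.mem_bot_iff_fixed]
      intro σ
      rcases hw σ (Finset.mem_univ σ) with h | h <;> simp [h]
    obtain ⟨α, hα⟩ := mem_bot.1 hw2
    exact ⟨α, (congrArg (algebraMap F⟮x⟯ (AlgebraicClosure F)) hα).symm⟩
  exact h

end ExponentTwo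

/-! ### The largest exponent-two extension with restricted ramification -/

section MaximalExtension

variable {F : Type*} [Field F] [NumberField F] (𝔫 : Ideal (𝓞 F))

/-- The square roots of elements of `F` that generate an extension unramified outside `𝔫`. -/
def unramifiedSqrts : Set (AlgebraicClosure F) :=
  {β | (∃ α, β ^ 2 = algebraMap F (AlgebraicClosure F) α) ∧
    ∀ v : HeightOneSpectrum (𝓞 F), RamifiesIn v (adjoin F {β}) → v.asIdeal ∣ 𝔫}

/-- An inertia element acting nontrivially on a subextension must move some generator `β`, so the
prime already ramifies in `F(β)`. -/
theorem isUnramifiedOutside_adjoin_unramifiedSqrts :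
    IsUnramifiedOutside 𝔫 (adjoin F (unramifiedSqrts 𝔫)) := by
  intro K hK _ v hv
  have := ((isAbelianOfExponentTwo_adjoin_sqrt fun β (hβ : β ∈ unramifiedSqrts 𝔫) =>
    hβ.1).mono hK).isGalois
  obtain ⟨Q, hQ, hQv, σ, hσ, x, hx, hσx⟩ := exists_inertia_of_ramifiesIn K v hv
  obtain ⟨β, ⟨⟨α, hα⟩, hβ⟩, hσβ⟩ := apply_ne_self_of_mem_adjoin σ (hK hx) hσx
  have := finiteDimensional_adjoin_sqrt hα
  have : IsGalois F F⟮β⟯ := isGalois_adjoin_sqrt (by rintro _ rfl; exact ⟨α, hα⟩)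
  exact hβ v (ramifiesIn_of_inertia F⟮β⟯ v Q hQv σ hσ (mem_adjoin_simple_self F β) hσβ)

theorem isGreatest_adjoin_unramifiedSqrts :
    IsGreatest {L : IntermediateField F (AlgebraicClosure F) | IsAbelianOfExponentTwo L ∧
      IsUnramifiedOutside 𝔫 L} (adjoin F (unramifiedSqrts 𝔫)) := by
  refine ⟨⟨isAbelianOfExponentTwo_adjoin_sqrt fun β hβ => hβ.1,
    isUnramifiedOutside_adjoin_unramifiedSqrts 𝔫⟩, fun L hL => ?_⟩
  refine hL.1.le_adjoin_sqrt.trans (adjoin.mono _ _ _ ?_)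
  rintro β ⟨hβL, α, hα⟩
  exact ⟨⟨α, hα⟩, fun v hv => hL.2 _ (adjoin_simple_le_iff.2 hβL)
    (finiteDimensional_adjoin_sqrt hα) v hv⟩

theorem adjoin_sqrt_le_of_twist (E : WeierstrassCurve F) [E.IsElliptic] (N : ℕ) (α : Fˣ)
    (hα : TwistImageMissesNegOne E N α) (β : AlgebraicClosure F)
    (hβ : β ^ 2 = algebraMap F (AlgebraicClosure F) α) :
    adjoin F {β} ≤ adjoin F (unramifiedSqrts (Ideal.span {(N : 𝓞 F)} * conductor E)) := by
  refine adjoin.mono _ _ _ (Set.singleton_subset_iff.2 ⟨⟨α, hβ⟩, fun v hv => ?_⟩)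
  rcases dvd_of_ramifiesIn_twist E N α hα β hβ v hv with h | h
  · exact h.mul_right _
  · exact h.mul_left _

end MaximalExtension
end EllipticTwist

namespace EllipticTwist

open IsDedekindDomain IntermediateField

/-! ### Elements all of whose valuations are even -/

section EvenValuation

open WithZero nonZeroDivisors

theorem isSquare_div_of_isSquare_iff {x y : ℤᵐ⁰} (hx : x ≠ 0) (hy : y ≠ 0)
    (h : IsSquare x ↔ IsSquare y) : IsSquare (x / y) := by
  have hexp (m : ℤ) : IsSquare (exp m : ℤᵐ⁰) ↔ Even m := by
    refine ⟨fun ⟨r, hr⟩ => ?_, fun ⟨r, hr⟩ => ⟨exp r, by rw [hr, exp_add]⟩⟩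
    have hr0 : r ≠ 0 := by
      rintro rfl
      rw [mul_zero] at hr
      exact exp_ne_zero hr
    rw [← exp_log hr0, ← exp_add, exp_inj] at hr
    exact ⟨_, hr⟩
  rw [← exp_log hx, ← exp_log hy] at h ⊢
  rw [hexp, hexp] at h
  rw [← exp_sub, hexp, Int.even_sub]
  exact h

variable {R K : Type*} [CommRing R] [IsDedekindDomain R] [Field K] [Algebra R K]
  [IsFractionRing R K]

theorem valuation_eq_exp_neg_count (v : HeightOneSpectrum R) {x : K} (hx : x ≠ 0) :
    v.valuation K x = exp (-FractionalIdeal.count K v (FractionalIdeal.spanSingleton R⁰ x)) := by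
  classical
  obtain ⟨n, d, hd, rfl⟩ := IsFractionRing.div_surjective (A := R) x
  have hd0 : d ≠ 0 := nonZeroDivisors.ne_zero hd
  have hn0 : n ≠ 0 := by
    rintro rfl
    simp at hx
  rw [FractionalIdeal.count_well_defined K v (a := d) (J := Ideal.span {n})
    (FractionalIdeal.spanSingleton_ne_zero_iff.2 hx), map_div₀,
    HeightOneSpectrum.valuation_of_algebraMap, HeightOneSpectrum.valuation_of_algebraMap,
    HeightOneSpectrum.intValuation_if_neg v hn0, HeightOneSpectrum.intValuation_if_neg v hd0,
    ← exp_sub]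
  · congr 1
    ring
  · rw [FractionalIdeal.coeIdeal_span_singleton, FractionalIdeal.spanSingleton_mul_spanSingleton]
    congr 1
    field_simp

/-- An element all of whose valuations are even generates the square of a fractional ideal. -/
theorem exists_sq_eq_toPrincipalIdeal (a : Kˣ)
    (h : ∀ v : HeightOneSpectrum R, IsSquare (v.valuation K (a : K))) :
    ∃ J : (FractionalIdeal R⁰ K)ˣ, J ^ 2 = toPrincipalIdeal R K a := by
  set I := FractionalIdeal.spanSingleton R⁰ (a : K) with hI
  have hI0 : I ≠ 0 := FractionalIdeal.spanSingleton_ne_zero_iff.2 a.ne_zero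
  have heven (v : HeightOneSpectrum R) : ∃ m : ℤ, FractionalIdeal.count K v I = m * 2 := by
    obtain ⟨r, hr⟩ := h v
    have hr0 : r ≠ 0 := by
      rintro rfl
      rw [mul_zero, Valuation.zero_iff] at hr
      exact a.ne_zero hr
    rw [valuation_eq_exp_neg_count v a.ne_zero, ← exp_log hr0, ← exp_add, exp_inj] at hr
    exact ⟨-log r, by linarith⟩
  choose m hm using heven
  have hfin : Function.HasFiniteMulSupport fun v : HeightOneSpectrum R =>
      (v.asIdeal : FractionalIdeal R⁰ K) ^ m v := by
    refine (Filter.eventually_cofinite.1 (FractionalIdeal.finite_factors I)).subset fun v hv h0 =>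
      hv ?_
    have hm0 : m v = 0 := by
      have := hm v
      omega
    simp [hm0]
  -- `J` is the product of primes with the halved exponents.
  have hJ : (∏ᶠ v : HeightOneSpectrum R, (v.asIdeal : FractionalIdeal R⁰ K) ^ m v) ^ 2 = I := by
    rw [finprod_pow hfin, ← FractionalIdeal.finprod_heightOneSpectrum_factorization' K hI0]
    refine finprod_congr fun v => ?_
    rw [hm, zpow_mul, ← zpow_natCast, Nat.cast_two]
  have hJ0 : (∏ᶠ v : HeightOneSpectrum R, (v.asIdeal : FractionalIdeal R⁰ K) ^ m v) ≠ 0 := by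
    intro h0
    rw [h0, zero_pow two_ne_zero] at hJ
    exact hI0 hJ.symm
  refine ⟨Units.mk0 _ hJ0, Units.ext ?_⟩
  rw [Units.val_pow_eq_pow_val, coe_toPrincipalIdeal]
  exact hJ

/-- If `J = (g)`, then `(a) = (g²)`, so `a` and `g²` differ by a unit. -/
theorem exists_unit_mul_sq (a : Kˣ) (J : (FractionalIdeal R⁰ K)ˣ)
    (hJ : J ^ 2 = toPrincipalIdeal R K a) (h : ClassGroup.mk K J = 1) :
    ∃ (u : Rˣ) (c : Kˣ), a = Units.map (algebraMap R K).toMonoidHom u * c ^ 2 := by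
  rw [ClassGroup.mk_eq_one_iff] at h
  have hg := FractionalIdeal.eq_spanSingleton_of_principal (J : FractionalIdeal R⁰ K)
  set g := Submodule.IsPrincipal.generator ((J : FractionalIdeal R⁰ K) : Submodule R K)
  have hg0 : g ≠ 0 := by
    intro h0
    rw [h0, FractionalIdeal.spanSingleton_zero] at hg
    exact J.ne_zero hg
  have hag : FractionalIdeal.spanSingleton R⁰ (g ^ 2) =
      FractionalIdeal.spanSingleton R⁰ (a : K) := by
    rw [← FractionalIdeal.spanSingleton_pow, ← hg, ← coe_toPrincipalIdeal, ← hJ,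
      Units.val_pow_eq_pow_val]
  have : Module.IsTorsionFree R K := Module.isTorsionFree_iff_faithfulSMul.2 inferInstance
  obtain ⟨z, hz⟩ := FractionalIdeal.spanSingleton_eq_spanSingleton.1 hag
  refine ⟨z, Units.mk0 g hg0, Units.ext ?_⟩
  rw [← hz]
  simp [Units.smul_def, Algebra.smul_def]

end EvenValuation

/-! ### Finiteness of square classes -/

section SquareClasses

/-- Finiteness modulo squares can be checked on the fibres of a map to a finite type. -/
theorem finite_image_of_fibers {G H ι : Type*} [Group G] [Group H] [Finite ι] (φ : G →* H) (f : G → ι)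
    {A B : Set G} (hB : (φ '' B).Finite) (h : ∀ a ∈ A, ∀ b ∈ A, f a = f b → a / b ∈ B) :
    (φ '' A).Finite := by
  have hc (i : ι) : (φ '' (A ∩ f ⁻¹' {i})).Finite := by
    rcases (A ∩ f ⁻¹' {i}).eq_empty_or_nonempty with h0 | ⟨b, hbA, hb⟩
    · simp [h0]
    · refine (hB.image (· * φ b)).subset ?_
      rintro _ ⟨a, ⟨haA, ha⟩, rfl⟩
      refine ⟨φ (a / b), ⟨a / b, h a haA b hbA (Eq.trans ha (Eq.symm hb)), rfl⟩, ?_⟩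
      change φ (a / b) * φ b = φ a
      rw [← map_mul, div_mul_cancel]
  refine (Set.finite_iUnion hc).subset ?_
  rintro _ ⟨a, ha, rfl⟩
  exact Set.mem_iUnion.2 ⟨f a, a, ⟨ha, rfl⟩, rfl⟩

variable {F : Type*} [Field F] [NumberField F]

/-- The unit group is finitely generated, and its image modulo squares is abelian of exponent two,
hence finite. -/
theorem finite_unit_square_classes :
    (QuotientGroup.mk' (powMonoidHom 2 : Fˣ →* Fˣ).range ''
      {a | ∃ (u : (𝓞 F)ˣ) (c : Fˣ), a = Units.map (algebraMap (𝓞 F) F).toMonoidHom u * c ^ 2}).Finite := by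
  set q := QuotientGroup.mk' (powMonoidHom 2 : Fˣ →* Fˣ).range
  have hq (c : Fˣ) : q c ^ 2 = 1 := by
    rw [← map_pow]
    exact (QuotientGroup.eq_one_iff _).2 ⟨c, rfl⟩
  set φ : (𝓞 F)ˣ →* Fˣ ⧸ (powMonoidHom 2 : Fˣ →* Fˣ).range :=
    q.comp (Units.map (algebraMap (𝓞 F) F).toMonoidHom)
  have : Group.FG (𝓞 F)ˣ := Group.fg_iff_monoid_fg.2 inferInstance
  have : Group.FG φ.range := Group.fg_range φ
  have htors : IsMulTorsion φ.range := by
    rintro ⟨_, u, rfl⟩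
    refine isOfFinOrder_iff_pow_eq_one.2 ⟨2, two_pos, Subtype.ext ?_⟩
    exact hq _
  have : Finite φ.range := CommGroup.finite_of_fg_isMulTorsion _ htors
  refine (Set.toFinite (φ.range : Set (Fˣ ⧸ (powMonoidHom 2 : Fˣ →* Fˣ).range))).subset ?_
  rintro _ ⟨_, ⟨u, c, rfl⟩, rfl⟩
  refine ⟨u, ?_⟩
  rw [map_mul, map_pow, hq]
  exact (mul_one (φ u)).symm

theorem finite_even_square_classes :
    (QuotientGroup.mk' (powMonoidHom 2 : Fˣ →* Fˣ).range ''
      {a | ∀ v : HeightOneSpectrum (𝓞 F), IsSquare (v.valuation F (a : F))}).Finite := by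
  classical
  -- `f a` is the class of a chosen `J` with `J² = (a)`; the fallback `1` is never compared. Equal
  -- classes make the quotient of the chosen ideals principal.
  let f (a : Fˣ) : ClassGroup (𝓞 F) :=
    if h : ∀ v : HeightOneSpectrum (𝓞 F), IsSquare (v.valuation F (a : F)) then
      ClassGroup.mk F (exists_sq_eq_toPrincipalIdeal a h).choose else 1
  refine finite_image_of_fibers _ f finite_unit_square_classes fun a ha b hb hab => ?_
  rw [Set.mem_ofPred_eq] at ha hb
  simp only [f, dif_pos ha, dif_pos hb] at hab
  refine exists_unit_mul_sq (a / b) ((exists_sq_eq_toPrincipalIdeal a ha).choose /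
    (exists_sq_eq_toPrincipalIdeal b hb).choose) ?_ ?_
  · rw [div_pow, (exists_sq_eq_toPrincipalIdeal a ha).choose_spec,
      (exists_sq_eq_toPrincipalIdeal b hb).choose_spec, map_div]
  · rw [map_div, hab, div_self']

/-- The parities at the finitely many `v ∈ S` take finitely many values, and two elements with equal
parities have a quotient that is even everywhere. -/
theorem finite_square_classes {S : Set (HeightOneSpectrum (𝓞 F))} (hS : S.Finite) :
    (QuotientGroup.mk' (powMonoidHom 2 : Fˣ →* Fˣ).range ''
      {a | ∀ v ∉ S, IsSquare (v.valuation F (a : F))}).Finite := by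
  have := hS.to_subtype
  refine finite_image_of_fibers _ (fun (a : Fˣ) (v : S) => IsSquare (v.1.valuation F (a : F)))
    finite_even_square_classes fun a ha b hb hab v => ?_
  rw [Units.val_div_eq_div_val, map_div₀]
  by_cases hv : v ∈ S
  · exact isSquare_div_of_isSquare_iff ((Valuation.ne_zero_iff _).2 a.ne_zero)
      ((Valuation.ne_zero_iff _).2 b.ne_zero) (iff_of_eq (congrFun hab ⟨v, hv⟩))
  · exact (ha v hv).div (hb v hv)

end SquareClasses

/-! ### Square classes of the twisting parameters -/

section TwistValuation

variable {F : Type*} [Field F] [NumberField F]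

/-- With ramification index `1` at a prime `w` above `v`, `v(α) = w(α) = w(β)²`. -/
theorem isSquare_valuation_of_not_ramifiesIn {Ω : Type*} [Field Ω] [Algebra F Ω] {α : F} {β : Ω}
    (hβ : β ^ 2 = algebraMap F Ω α) (v : HeightOneSpectrum (𝓞 F)) (h : ¬ RamifiesIn v F⟮β⟯) :
    IsSquare (v.valuation F α) := by
  have := finiteDimensional_adjoin_sqrt hβ
  have : NumberField F⟮β⟯ := NumberField.of_module_finite F F⟮β⟯
  obtain ⟨⟨P, hP, hPv⟩⟩ := v.asIdeal.nonempty_primesOver (S := 𝓞 F⟮β⟯)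
  let w : HeightOneSpectrum (𝓞 F⟮β⟯) := ⟨P, hP, Ideal.ne_bot_of_liesOver_of_ne_bot v.ne_bot P⟩
  have hw : w.asIdeal.LiesOver v.asIdeal := hPv
  have he : v.asIdeal.ramificationIdx' P = 1 := by
    have h0 := Ideal.IsDedekindDomain.ramificationIdx'_ne_zero_of_liesOver P v.ne_bot
    have h1 : P.ramificationIdx (𝓞 F) ≤ 1 := not_lt.1 fun h' => h ⟨P, hP, hPv, h'⟩
    rw [← Ideal.ramificationIdx'_eq_ramificationIdx v.asIdeal P v.ne_bot] at h1
    omega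
  have hval := HeightOneSpectrum.valuation_liesOver F⟮β⟯ v w α
  have hα : algebraMap F F⟮β⟯ α = AdjoinSimple.gen F β ^ 2 := Subtype.ext hβ.symm
  rw [show v.asIdeal.ramificationIdx' w.asIdeal = 1 from he, pow_one, hα, map_pow] at hval
  rw [hval]
  exact IsSquare.sq _

theorem isSquare_valuation_of_twist (E : WeierstrassCurve F) [E.IsElliptic] (N : ℕ) (α : Fˣ)
    (hα : TwistImageMissesNegOne E N α) (v : HeightOneSpectrum (𝓞 F))
    (hv : ¬ (v.asIdeal ∣ Ideal.span {(N : 𝓞 F)} ∨ v.asIdeal ∣ conductor E)) :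
    IsSquare (v.valuation F (α : F)) := by
  obtain ⟨β, hβ⟩ := IsAlgClosed.exists_pow_nat_eq (algebraMap F (AlgebraicClosure F) α) two_pos
  exact isSquare_valuation_of_not_ramifiesIn hβ v fun h =>
    hv (dvd_of_ramifiesIn_twist E N α hα β hβ v h)

theorem conductor_ne_zero (E : WeierstrassCurve F) : conductor E ≠ 0 :=
  finprod_induction (· ≠ 0) one_ne_zero (fun _ _ => mul_ne_zero) fun v =>
    pow_ne_zero _ v.ne_bot

theorem finite_twist_square_classes (E : WeierstrassCurve F) [E.IsElliptic] {N : ℕ} (hN : N ≠ 0) :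
    {c : Fˣ ⧸ (powMonoidHom 2 : Fˣ →* Fˣ).range |
      ∃ α : Fˣ, TwistImageMissesNegOne E N α ∧ (QuotientGroup.mk α) = c}.Finite := by
  have hN0 : Ideal.span {(N : 𝓞 F)} ≠ 0 := by
    rw [Ne, Ideal.zero_eq_bot, Ideal.span_singleton_eq_bot]
    exact_mod_cast hN
  refine (finite_square_classes ((Ideal.finite_factors hN0).union
    (Ideal.finite_factors (conductor_ne_zero E)))).subset ?_
  rintro _ ⟨α, hα, rfl⟩
  exact ⟨α, fun v hv => isSquare_valuation_of_twist E N α hα v hv, rfl⟩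

theorem zpow_eq_pow_fin_two_mul_sq {G : Type*} [Group G] (g : G) (m : ℤ) :
    ∃ (k : Fin 2) (c : G), g ^ m = g ^ (k : ℕ) * c ^ 2 := by
  -- Integer `%` has nonnegative remainder, so `toNat` loses nothing for negative `m`.
  refine ⟨⟨(m % 2).toNat, by omega⟩, g ^ (m / 2), ?_⟩
  rw [← zpow_natCast g, ← zpow_natCast (g ^ (m / 2)), ← zpow_mul, ← zpow_add]
  congr 1
  push_cast
  omega

/-- Dividing `α` by the `π_i` at which its valuation is odd leaves an element even everywhere. In
class number one it is a unit times a square, and the unit is `±u^m` with only the parity of `m`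
relevant. -/
theorem exists_mem_twistSet {n : ℕ} (π : Fin n → 𝓞 F) (u : (𝓞 F)ˣ) (hclass : NumberField.classNumber F = 1)
    (hu : Subgroup.closure {-1, u} = ⊤) (p : Fin n → HeightOneSpectrum (𝓞 F))
    (hp : Function.Injective p) (hπ : ∀ i, (p i).asIdeal = Ideal.span {π i}) (α : Fˣ)
    (hα : ∀ v ∉ Set.range p, IsSquare (v.valuation F (α : F))) :
    ∃ a ∈ twistSet u π, ∃ c : Fˣ, (α : F) = algebraMap (𝓞 F) F a * (c : F) ^ 2 := by
  have hπ0 (i : Fin n) : π i ≠ 0 := fun h0 => (p i).ne_bot (by rw [hπ, h0]; simp)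
  have hself (i : Fin n) : (p i).valuation F (π i : F) = WithZero.exp (-1) := by
    rw [HeightOneSpectrum.valuation_of_algebraMap,
      HeightOneSpectrum.intValuation_singleton _ (hπ0 i) (hπ i)]
  have hother (v : HeightOneSpectrum (𝓞 F)) (i : Fin n) (h : v ≠ p i) :
      v.valuation F (π i : F) = 1 := by
    rw [HeightOneSpectrum.valuation_eq_one_iff_notMem]
    intro hmem
    refine h (HeightOneSpectrum.ext ?_)
    refine ((p i).isMaximal.eq_of_le v.isPrime.ne_top ?_).symm
    rwa [hπ, Ideal.span_singleton_le_iff_mem]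
  have hk (i : Fin n) : ∃ k : Fin 2,
      IsSquare ((p i).valuation F (α : F) / (p i).valuation F (π i : F) ^ (k : ℕ)) := by
    have h0 : (p i).valuation F (α : F) ≠ 0 := (Valuation.ne_zero_iff _).2 α.ne_zero
    rw [hself, ← WithZero.exp_log h0]
    rcases Int.even_or_odd' (WithZero.log ((p i).valuation F (α : F))) with ⟨m, hm | hm⟩
    · refine ⟨0, WithZero.exp m, ?_⟩
      rw [hm, ← WithZero.exp_add]
      simp [two_mul]
    · refine ⟨1, WithZero.exp (m + 1), ?_⟩
      rw [hm, ← WithZero.exp_add, Fin.val_one, pow_one, ← WithZero.exp_sub]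
      congr 1
      ring
  choose k hk using hk
  set x : F := ∏ i, (π i : F) ^ (k i : ℕ) with hx
  have hx0 : x ≠ 0 := Finset.prod_ne_zero_iff.2 fun i _ =>
    pow_ne_zero _ (by exact_mod_cast hπ0 i)
  have heven (v : HeightOneSpectrum (𝓞 F)) :
      IsSquare (v.valuation F ((α / Units.mk0 x hx0 : Fˣ) : F)) := by
    rw [Units.val_div_eq_div_val, Units.val_mk0, map_div₀, hx, map_prod]
    by_cases hv : v ∈ Set.range p
    · obtain ⟨i, rfl⟩ := hv
      rw [Finset.prod_eq_single i, map_pow]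
      · exact hk i
      · intro j _ hji
        rw [map_pow, hother _ j fun h => hji (hp h).symm, one_pow]
      · simp
    · rw [Finset.prod_eq_one, div_one]
      · exact hα v hv
      · intro j _
        rw [map_pow, hother _ j fun h => hv ⟨j, h.symm⟩, one_pow]
  obtain ⟨J, hJ⟩ := exists_sq_eq_toPrincipalIdeal _ heven
  have hJ1 : ClassGroup.mk F J = 1 := by
    rw [NumberField.classNumber, Fintype.card_eq_one_iff] at hclass
    obtain ⟨c, hc⟩ := hclass
    rw [hc (ClassGroup.mk F J), hc 1]
  obtain ⟨w, c, hwc⟩ := exists_unit_mul_sq _ J hJ hJ1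
  have hw : w ∈ Subgroup.closure {-1, u} := hu ▸ Subgroup.mem_top w
  obtain ⟨l, m, hlm⟩ := Subgroup.mem_closure_pair.1 hw
  obtain ⟨k₀, d, hd⟩ := zpow_eq_pow_fin_two_mul_sq u m
  refine ⟨((-1 : (𝓞 F)ˣ) ^ l : (𝓞 F)ˣ) * (u : 𝓞 F) ^ (k₀ : ℕ) * ∏ i, π i ^ (k i : ℕ),
    ⟨_, k₀, k, ?_, rfl⟩, Units.map (algebraMap (𝓞 F) F).toMonoidHom d * c, ?_⟩
  · rcases Int.even_or_odd l with h | h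
    · left
      rw [h.neg_one_zpow, Units.val_one]
    · right
      rw [h.neg_one_zpow, Units.val_neg, Units.val_one]
  · have h1 := congrArg (fun z : Fˣ => (z : F)) hwc
    have h2 := congrArg (fun z : (𝓞 F)ˣ => algebraMap (𝓞 F) F (z : 𝓞 F)) (hlm.symm.trans (by rw [hd]))
    simp only [Units.val_mul, Units.val_pow_eq_pow_val, Units.val_div_eq_div_val, Units.val_mk0,
      map_mul, map_pow] at h1 h2
    rw [div_eq_iff hx0] at h1
    rw [h1, hx]
    simp only [Units.coe_map, Units.val_mul, map_mul, map_prod, map_pow]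
    change algebraMap (𝓞 F) F (w : 𝓞 F) * _ * _ = _ * (algebraMap (𝓞 F) F (d : 𝓞 F) * _) ^ 2
    rw [h2]
    ring

end TwistValuation
end EllipticTwist
open EllipticTwist IsDedekindDomain in
theorem mainTheorem10 {F : Type*} [Field F] [NumberField F] (E : WeierstrassCurve F)
    [E.IsElliptic] (N : ℕ) (hN : 2 < N) :
    -- (1) `√α` lies in `F(E[N])`
    (∀ α : Fˣ, TwistImageMissesNegOne E N α →
      ∀ β : AlgebraicClosure F, β ^ 2 = algebraMap F (AlgebraicClosure F) α →
        β ∈ divisionField E N) ∧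
    -- (2) only primes dividing `N` or the conductor can ramify in `F(√α) / F`
    (∀ α : Fˣ, TwistImageMissesNegOne E N α →
      ∀ β : AlgebraicClosure F, β ^ 2 = algebraMap F (AlgebraicClosure F) α →
        ∀ v : HeightOneSpectrum (𝓞 F), RamifiesIn v (IntermediateField.adjoin F {β}) →
          v.asIdeal ∣ Ideal.span {(N : 𝓞 F)} ∨ v.asIdeal ∣ conductor E) ∧
    -- (3) `F(√α)` lies in the maximal abelian extension of exponent `2` unramified outside
    -- the infinite places and the primes dividing `N` times the conductor
    (∃ M : IntermediateField F (AlgebraicClosure F),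
      IsGreatest {L : IntermediateField F (AlgebraicClosure F) | IsAbelianOfExponentTwo L ∧
        IsUnramifiedOutside (Ideal.span {(N : 𝓞 F)} * conductor E) L} M ∧
      ∀ α : Fˣ, TwistImageMissesNegOne E N α →
        ∀ β : AlgebraicClosure F, β ^ 2 = algebraMap F (AlgebraicClosure F) α →
          IntermediateField.adjoin F {β} ≤ M) ∧
    -- (4) finitely many classes of `α` modulo squares
    {c : Fˣ ⧸ (powMonoidHom 2 : Fˣ →* Fˣ).range |
      ∃ α : Fˣ, TwistImageMissesNegOne E N α ∧ (QuotientGroup.mk α) = c}.Finite ∧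
    -- (5) real quadratic fields of class number one
    (Module.finrank ℚ F = 2 → NumberField.IsTotallyReal F → NumberField.classNumber F = 1 →
      ∀ (n : ℕ) (p : Fin n → Ideal (𝓞 F)) (π : Fin n → 𝓞 F) (u : (𝓞 F)ˣ),
        Function.Injective p →
        Set.range p = {q : Ideal (𝓞 F) | q.IsPrime ∧ q ≠ ⊥ ∧
          q ∣ Ideal.span {((N * Ideal.absNorm (conductor E) : ℕ) : 𝓞 F)}} →
        (∀ i, p i = Ideal.span {π i}) →
        Subgroup.closure {-1, u} = ⊤ →
        ∀ α : Fˣ, TwistImageMissesNegOne E N α →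
          ∃ a ∈ twistSet u π, ∃ c : Fˣ, (α : F) = algebraMap (𝓞 F) F a * (c : F) ^ 2) := by
  refine ⟨fun α hα β hβ => mem_divisionField_of_twist E N α hα β hβ,
    fun α hα β hβ v hv => dvd_of_ramifiesIn_twist E N α hα β hβ v hv,
    ⟨_, isGreatest_adjoin_unramifiedSqrts _,
      fun α hα β hβ => adjoin_sqrt_le_of_twist E N α hα β hβ⟩,
    finite_twist_square_classes E (by omega), ?_⟩
  intro _ _ hclass n p π u hp hrange hπ hu α hα
  have hmem (i : Fin n) : p i ∈ {q : Ideal (𝓞 F) | q.IsPrime ∧ q ≠ ⊥ ∧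
      q ∣ Ideal.span {((N * Ideal.absNorm (conductor E) : ℕ) : 𝓞 F)}} := hrange ▸ ⟨i, rfl⟩
  refine exists_mem_twistSet π u hclass hu (fun i => ⟨p i, (hmem i).1, (hmem i).2.1⟩)
    (fun i j hij => hp (congrArg HeightOneSpectrum.asIdeal hij)) hπ α fun v hv =>
    isSquare_valuation_of_twist E N α hα v fun hdvd => hv ?_
  have hv' : v.asIdeal ∈ Set.range p := by
    rw [hrange]
    refine ⟨v.isPrime, v.ne_bot, ?_⟩
    rw [Ideal.dvd_span_singleton, Nat.cast_mul]
    rcases hdvd with h | h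
    · exact Ideal.mul_mem_right _ _ (Ideal.dvd_span_singleton.1 h)
    -- An ideal contains its absolute norm, so a prime dividing the conductor contains `N_E`.
    · exact Ideal.mul_mem_left _ _ (Ideal.dvd_iff_le.1 h (Ideal.absNorm_mem _))
  obtain ⟨i, hi⟩ := hv'
  exact ⟨i, HeightOneSpectrum.ext hi⟩
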